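/- **Global dual basis.** Let $d,k\ge 1$. Let $\Omega\subset\mathbb R^d$ be a bounded polyhedral domain (open, connected, $\overline\Omega$ a finite union of polytopes) which equals the interior of its closure and is locally connected at its boundary, i.e. every $x\in\partial\Omega$ has arbitrarily small open neighbourhoods $V$ with $V\cap\Omega$ connected (for instance, a Lipschitz polyhedral domain). Let $\mathcal T$ be a (finite, conforming) triangulation of $\overline\Omega$ into closed, nondegenerate $d$-simplices. For $T\in\mathcal T$ let $(\lambda_v)_v$ denote its barycentric coordinates, indexed by the vertices $v$ of $T$. Let $\mathcal N$ be the set of Lagrange nodes of order $k$, i.e. of the points $\sum_{v}\frac{\alpha_v}{k}v$, where $T\in\mathcal T$, $v$ runs through the vertices of $T$, and $\alpha$ is a multi-index on these vertices with $|\alpha|=k$. For $i\in\mathcal N$ let $\mathcal T(\omega_i)=\{T\in\mathcal T: i\in T\}$ and $\omega_i=\bigcup\mathcal T(\omega_i)$, and let $b_i$ be the Bernstein basis function: $b_i|_T=\frac{k!}{\alpha!}\lambda^\alpha$ with $\alpha_v=k\lambda_v(i)$ for $T\in\mathcal T(\omega_i)$, and $b_i=0$ outside $\omega_i$. Let $\mathcal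 L^1_m(\mathcal T)$ be the space of $W^{1,1}(\Omega)$-functions whose restriction to each (closed) $T\in\mathcal T$ is a polynomial of degree at most $m$ (these are continuous on $\overline\Omega$), and let $\mathcal L^1_m(\omega_i)$ be the analogous space for $\mathcal T(\omega_i)$ on the interior of $\omega_i$. Write $\langle f,g\rangle_\Omega=\int_\Omega fg\,\mathrm dx$. Call $\mathcal T$ shape regular with constant $\gamma$ if every $T\in\mathcal T$ contains a ball of some radius $r>0$ with $\operatorname{diam}(T)\le\gamma r$ and, in the case $d=1$, moreover $\operatorname{diam}(T)\le\gamma\operatorname{diam}(T')$ for all $T,T'\in\mathcal T$ with $T\cap T'\ne\emptyset$. Then there are a constant $C_1$ depending only on $d$ and $k$, and constants $C_2(\gamma)$ depending only on $d$, $k$ and $\gamma$, such that for all such $\Omega$ and $\mathcal T$ there exist functions $\psi_i\in\mathcal L^1_{3k}(\mathcal T)$, $i\in\mathcal N$, with the following properties. 1. (Product structure) For each $i\in\mathcal N$ there is $\zeta_i\in\mathcal L^1_{2k}(\omega_i)$ with $\psi_i=b_i\zeta_i$ (understood as $0$ outside $\omega_i$); in particular $\operatorname{supp}\psi_i\subset\operatorname{supp}b_i$.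 2. (Biorthogonality) $\langle b_i,\psi_j\rangle_\Omega=\delta_{i,j}$ for all $i,j\in\mathcal N$. 3. (Boundedness) For all $i\in\mathcal N$, $$\|\psi_i\|_{L^\infty(\omega_i)}\le C_1\,|\omega_i|^{-1},$$ and, whenever $\mathcal T$ is shape regular with constant $\gamma$, $$\|\nabla\psi_i\|_{L^\infty(\omega_i)}\le C_2(\gamma)\,\operatorname{diam}(\omega_i)^{-1}|\omega_i|^{-1}.$$ 4. (Preservation of mass) $\sum_{i\in\mathcal N}\langle 1,b_i\rangle_\Omega\,\psi_i=1$ on $\overline\Omega$. -/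

import Mathlib

open MeasureTheory Set
open scoped ContDiff ENNReal Topology

noncomputable section

namespace LagrangeFE

/-- The Euclidean space `ℝ^d`. -/
abbrev Eu (d : ℕ) := EuclideanSpace ℝ (Fin d)

/-! ### Sobolev functions -/

/-- `g` is the weak gradient of `v` on the open set `U`. -/
def HasWeakGradient {d : ℕ} (U : Set (Eu d)) (v : Eu d → ℝ) (g : Eu d → Eu d) : Prop :=
  ∀ φ : Eu d → ℝ, ContDiff ℝ ∞ φ → HasCompactSupport φ → tsupport φ ⊆ U → ∀ e : Eu d,
    ∫ x in U, v x * fderiv ℝ φ x e = - ∫ x in U, inner ℝ (g x) e * φ x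

/-- `v ∈ W^{1,1}(U)`. -/
def MemW11 {d : ℕ} (U : Set (Eu d)) (v : Eu d → ℝ) : Prop :=
  IntegrableOn v U ∧ ∃ g : Eu d → Eu d, IntegrableOn g U ∧ HasWeakGradient U v g

/-! ### Domains and triangulations -/

/-- A bounded polyhedral domain. The last two conditions say that the domain lies locally on one
side of its boundary and that its boundary has no pinch points; every Lipschitz domain has both
properties. Boundedness is part of `polyhedral`. -/
structure IsPolyhedralDomain {d : ℕ} (Ω : Set (Eu d)) : Prop where
  isOpen : IsOpen Ω
  isConnected : IsConnected Ω
  polyhedral : ∃ P : Finset (Finset (Eu d)), closure Ω = ⋃ p ∈ P, convexHull ℝ (p : Set (Eu d))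
  interior_closure : interior (closure Ω) = Ω
  connected_at_boundary : ∀ x ∈ frontier Ω, ∀ U ∈ 𝓝 x,
    ∃ V ⊆ U, IsOpen V ∧ x ∈ V ∧ IsConnected (V ∩ Ω)

/-- A (conforming) triangulation of `Ω`: a finite simplicial complex with underlying space the
closure of `Ω`, each of whose faces is a face of a `d`-simplex of the complex. Simplices are
represented by their finite sets of vertices. -/
structure Triangulation {d : ℕ} (Ω : Set (Eu d)) extends Geometry.SimplicialComplex ℝ (Eu d) where
  finite_faces : faces.Finite
  exists_cell : ∀ s ∈ faces, ∃ t ∈ faces, s ⊆ t ∧ t.card = d + 1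
  space_eq : toSimplicialComplex.space = closure Ω

/-- The closed simplex spanned by a finite set of vertices. -/
def simplex {d : ℕ} (T : Finset (Eu d)) : Set (Eu d) := convexHull ℝ (T : Set (Eu d))

open Classical in
/-- The barycentric coordinate `λ_v` of the nondegenerate `d`-simplex with vertex set `T`, as an
affine function on the whole space; by convention it is `0` if `v` is not a vertex of `T`. -/
def bary {d : ℕ} (T : Finset (Eu d)) (v x : Eu d) : ℝ :=
  if h : AffineIndependent ℝ ((↑) : T → Eu d) ∧
      affineSpan ℝ (range ((↑) : T → Eu d)) = ⊤ ∧ v ∈ T then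
    (AffineBasis.mk ((↑) : T → Eu d) h.1 h.2.1).coord ⟨v, h.2.2⟩ x
  else 0

/-- The multi-index `α(i,T)` of a Lagrange node `i` of order `k` in the simplex `T`: its entries
are `k λ_v(i)`, which are natural numbers (see `multiIndex_node`). -/
def multiIndex {d : ℕ} (k : ℕ) (T : Finset (Eu d)) (i v : Eu d) : ℕ := ⌊k * bary T v i⌋₊

/-- The Bernstein polynomial `b_α = |α|! / α! λ^α` of the simplex `T`. -/
def bernsteinLocal {d : ℕ} (T : Finset (Eu d)) (α : Eu d → ℕ) (x : Eu d) : ℝ :=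
  (Nat.factorial (∑ v ∈ T, α v) : ℝ) / (∏ v ∈ T, (Nat.factorial (α v) : ℝ)) *
    ∏ v ∈ T, bary T v x ^ α v

/-- `f` restricted to the set `S` is a polynomial of total degree at most `m`. -/
def IsPolyOn {d : ℕ} (m : ℕ) (S : Set (Eu d)) (f : Eu d → ℝ) : Prop :=
  ∃ p : MvPolynomial (Fin d) ℝ, p.totalDegree ≤ m ∧
    ∀ x ∈ S, f x = MvPolynomial.eval (fun j => x j) p

/-- The Lagrange space of order `m` on the open set `U`, whose closure is the union of the simplices
in `C`: the `W^{1,1}(U)`-functions whose restriction to each simplex in `C` is a polynomial of degree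
at most `m`. Since the simplices are closed, such a function is continuous on their union. -/
def lagrangeSpace {d : ℕ} (U : Set (Eu d)) (C : Finset (Finset (Eu d))) (m : ℕ) :
    Set (Eu d → ℝ) :=
  {f | MemW11 U f ∧ ∀ T ∈ C, IsPolyOn m (simplex T) f}

namespace Triangulation

variable {d : ℕ} {Ω : Set (Eu d)} (𝒯 : Triangulation Ω)

open Classical in
/-- The `d`-simplices of the triangulation. -/
def cells : Finset (Finset (Eu d)) := {T ∈ 𝒯.finite_faces.toFinset | T.card = d + 1}

open Classical in
/-- The Lagrange nodes of order `k`: the points `∑ (α_v / k) v` for the `d`-simplices `T` and the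
multi-indices `α` on the vertices of `T` with `|α| = k`. -/
def nodes (k : ℕ) : Finset (Eu d) :=
  𝒯.cells.biUnion fun T => (T.piAntidiag k).image fun α => ∑ v ∈ T, ((α v : ℝ) / k) • v

open Classical in
/-- The `d`-simplices that contain the point `i`. -/
def cellsAt (i : Eu d) : Finset (Finset (Eu d)) := {T ∈ 𝒯.cells | i ∈ simplex T}

/-- The patch `ω_i`, the union of the `d`-simplices that contain `i`. -/
def patch (i : Eu d) : Set (Eu d) := ⋃ T ∈ 𝒯.cellsAt i, simplex T

open Classical in
/-- The global Bernstein basis function `b_i` of order `k`. On a simplex that contains `i` it is the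
local Bernstein polynomial for `α(i,T)` (by `bernstein_eq` the value does not depend on the choice
of the simplex `T` containing `i` and `x`), elsewhere it vanishes. -/
def bernstein (k : ℕ) (i x : Eu d) : ℝ :=
  if h : ∃ T ∈ 𝒯.cellsAt i, x ∈ simplex T then
    bernsteinLocal h.choose (multiIndex k h.choose i) x
  else 0

/-- Shape regularity with constant `γ`: the diameter of each simplex is at most `γ` times the radius
of some ball that it contains. For `d = 1` this is void, and shape regularity means that
the lengths of touching intervals are comparable. -/
def ShapeRegular (γ : ℝ) : Prop :=
  (∀ T ∈ 𝒯.cells, ∃ c : Eu d, ∃ r : ℝ, 0 < r ∧ Metric.closedBall c r ⊆ simplex T ∧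
    Metric.diam (simplex T) ≤ γ * r) ∧
  (d = 1 → ∀ T ∈ 𝒯.cells, ∀ T' ∈ 𝒯.cells, (simplex T ∩ simplex T').Nonempty →
    Metric.diam (simplex T) ≤ γ * Metric.diam (simplex T'))

/-! ### The global Bernstein functions are well defined -/

theorem mem_cells {T : Finset (Eu d)} : T ∈ 𝒯.cells ↔ T ∈ 𝒯.faces ∧ T.card = d + 1 := by
  simp [cells]

theorem indep_of_cells {T : Finset (Eu d)} (hT : T ∈ 𝒯.cells) :
    AffineIndependent ℝ ((↑) : T → Eu d) := 𝒯.indep (𝒯.mem_cells.1 hT).1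

theorem span_of_cells {T : Finset (Eu d)} (hT : T ∈ 𝒯.cells) :
    affineSpan ℝ (range ((↑) : T → Eu d)) = ⊤ := by
  rw [(𝒯.indep_of_cells hT).affineSpan_eq_top_iff_card_eq_finrank_add_one]
  simp [(𝒯.mem_cells.1 hT).2]

theorem bary_of_notMem {T : Finset (Eu d)} {v : Eu d} (hv : v ∉ T) (x : Eu d) :
    bary T v x = 0 := by
  simp [bary, hv]

/-- Barycentric coordinates are determined by the affine representation of a point. -/
theorem bary_sum {T : Finset (Eu d)} (hT : T ∈ 𝒯.cells) (w : Eu d → ℝ)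
    (hw : ∑ v ∈ T, w v = 1) {v : Eu d} (hv : v ∈ T) :
    bary T v (∑ u ∈ T, w u • u) = w v := by
  have h1 : ∑ u : T, w u = 1 := by rw [Finset.sum_coe_sort T w]; exact hw
  have h2 : ∑ u ∈ T, w u • u
      = Finset.univ.affineCombination ℝ ((↑) : T → Eu d) (fun u : T => w u) := by
    rw [Finset.affineCombination_eq_linear_combination _ _ _ h1,
      Finset.sum_coe_sort T (fun u => w u • u)]
  rw [bary, dif_pos ⟨𝒯.indep_of_cells hT, 𝒯.span_of_cells hT, hv⟩, h2]
  exact AffineBasis.coord_apply_combination_of_mem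
    (AffineBasis.mk ((↑) : T → Eu d) (𝒯.indep_of_cells hT) (𝒯.span_of_cells hT))
    (s := Finset.univ) (i := ⟨v, hv⟩) (Finset.mem_univ _) h1

/-- At the Lagrange node given by `α`, the multi-index is `α`. -/
theorem multiIndex_node {k : ℕ} (hk : 1 ≤ k) {T : Finset (Eu d)} (hT : T ∈ 𝒯.cells)
    (α : Eu d → ℕ) (hα : ∑ v ∈ T, α v = k) {v : Eu d} (hv : v ∈ T) :
    multiIndex k T (∑ u ∈ T, ((α u : ℝ) / k) • u) v = α v := by
  have hk' : (k : ℝ) ≠ 0 := by positivity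
  have h1 : ∑ u ∈ T, ((α u : ℝ) / k) = 1 := by
    rw [← Finset.sum_div, ← Nat.cast_sum, hα, div_self hk']
  rw [multiIndex, 𝒯.bary_sum hT _ h1 hv, mul_div_cancel₀ _ hk', Nat.floor_natCast]

/-- On the intersection of two cells the barycentric coordinates agree. -/
theorem bary_eq_of_mem {T T' : Finset (Eu d)} (hT : T ∈ 𝒯.cells) (hT' : T' ∈ 𝒯.cells)
    {x : Eu d} (hx : x ∈ simplex T) (hx' : x ∈ simplex T') (v : Eu d) :
    bary T v x = bary T' v x := by
  classical
  have h := 𝒯.inter_subset_convexHull (𝒯.mem_cells.1 hT).1 (𝒯.mem_cells.1 hT').1 ⟨hx, hx'⟩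
  rw [← Finset.coe_inter, Finset.mem_convexHull'] at h
  obtain ⟨w, -, hw1, hwx⟩ := h
  have key : ∀ S ∈ 𝒯.cells, T ∩ T' ⊆ S →
      bary S v x = if v ∈ T ∩ T' then w v else 0 := by
    intro S hS hsub
    let w' : Eu d → ℝ := fun u => if u ∈ T ∩ T' then w u else 0
    have e1 : ∑ u ∈ S, w' u = 1 := by
      rw [← hw1, ← Finset.sum_subset hsub (f := w')]
      · exact Finset.sum_congr rfl fun u hu => if_pos hu
      · intro u _ hu; exact if_neg hu
    have e2 : ∑ u ∈ S, w' u • u = x := by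
      rw [← hwx, ← Finset.sum_subset hsub (f := fun u => w' u • u)]
      · exact Finset.sum_congr rfl fun u hu => by simp only [w', if_pos hu]
      · intro u _ hu; simp only [w', if_neg hu, zero_smul]
    by_cases hv : v ∈ S
    · rw [← e2, 𝒯.bary_sum hS w' e1 hv]
    · rw [bary_of_notMem hv, if_neg fun h => hv (hsub h)]
  rw [key T hT Finset.inter_subset_left, key T' hT' Finset.inter_subset_right]

/-- The local formula for `b_i` on every cell that contains `i`. -/
theorem bernstein_eq (k : ℕ) {i x : Eu d} {T : Finset (Eu d)} (hT : T ∈ 𝒯.cellsAt i)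
    (hx : x ∈ simplex T) :
    𝒯.bernstein k i x = bernsteinLocal T (multiIndex k T i) x := by
  classical
  have h : ∃ T ∈ 𝒯.cellsAt i, x ∈ simplex T := ⟨T, hT, hx⟩
  rw [bernstein, dif_pos h]
  obtain ⟨hS, hxS⟩ := h.choose_spec
  generalize h.choose = S at hS hxS
  simp only [cellsAt, Finset.mem_filter] at hT hS
  have hα : multiIndex k S i = multiIndex k T i := by
    funext v; rw [multiIndex, multiIndex, 𝒯.bary_eq_of_mem hS.1 hT.1 hS.2 hT.2 v]
  have h0 : ∀ R : Finset (Eu d), ∀ v, v ∉ R → multiIndex k R i v = 0 := by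
    intro R v hv; simp [multiIndex, bary_of_notMem hv]
  have hl : ∀ v, bary S v x = bary T v x := 𝒯.bary_eq_of_mem hS.1 hT.1 hxS hx
  have hu : ∀ R : Finset (Eu d), (∀ v ∉ R, multiIndex k T i v = 0) → R ⊆ S ∪ T →
      (∀ v, bary R v x = bary T v x) →
      bernsteinLocal R (multiIndex k T i) x =
        (Nat.factorial (∑ v ∈ S ∪ T, multiIndex k T i v) : ℝ) /
          (∏ v ∈ S ∪ T, (Nat.factorial (multiIndex k T i v) : ℝ)) *
          ∏ v ∈ S ∪ T, bary T v x ^ multiIndex k T i v := by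
    intro R hR hsub hb
    unfold bernsteinLocal
    rw [Finset.sum_subset hsub fun v _ hv => hR v hv,
      Finset.prod_subset hsub (f := fun v => (Nat.factorial (multiIndex k T i v) : ℝ))
        fun v _ hv => by simp [hR v hv],
      Finset.prod_subset hsub (f := fun v => bary R v x ^ multiIndex k T i v)
        fun v _ hv => by simp [hR v hv]]
    simp only [hb]
  rw [hα, hu S (fun v hv => hα ▸ h0 S v hv) Finset.subset_union_left hl,
    hu T (h0 T) Finset.subset_union_right fun _ => rfl]

end Triangulation

end LagrangeFE

end

/-!
Everything is reduced to the reference simplex. Let `I` be the normalised integral over a simplex,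
viewed as a functional on polynomials in the barycentric coordinates, and let `b_α` be the Bernstein
polynomials of degree `k`. It suffices to find `Z_α` of degree at most `2k` with
`I (b_β b_α Z_α) = δ_{αβ}` and `∑_α I(b_α) b_α Z_α = 1` on the simplex: on a cell containing the
node `i`, put `ζ_i = Z_α / |ω_i|`, where `α` is the multi-index of `i`. Averaging over the vertex
permutations makes the family `Z` equivariant, so that `ζ_i` is well defined and continuous.

Without the second condition, the weighted Gram matrices `I (b_α b_β b_γ)` would give `Z_α` of
degree `k`. To have both conditions at once, write `Z_α = I(b_α)⁻¹ (q_α - Q + 1)` with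
`Q = ∑_β b_β q_β` and `q_β` homogeneous of degree `k`; then `∑_α I(b_α) b_α Z_α = 1` automatically
since `∑_α b_α = 1`. Biorthogonality is now a linear equation for `q` with the symmetric positive
semidefinite form `(q, r) ↦ I (∑_α b_α (q_α - Q) r_α)`, and the right hand side vanishes on its
kernel: there `I (∑_α b_α (r_α - R)²) = 0` forces all `r_α` to be the same polynomial.

For the gradient bound, the ball of radius `r` inside a cell makes its barycentric coordinates
Lipschitz with constant `(2 r)⁻¹`, which is comparable to `diam(T)⁻¹`. By a packing argument at most
`γ ^ d` cells contain `i`. If `d ≥ 2`, any two of them are joined by a chain in which consecutive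
cells share an edge, because `Ω` has no pinch point at `i`; so all cells at `i` have diameter
comparable to `diam(ω_i)`.
-/

noncomputable section

namespace LagrangeFE

section DualBasis

theorem exists_eq_of_forall_isotropic {K V : Type*} [Field K] [AddCommGroup V] [Module K V]
    [FiniteDimensional K V] (A : V →ₗ[K] V →ₗ[K] K) (F : V →ₗ[K] K)
    (hF : ∀ y, A y y = 0 → F y = 0) : ∃ x, A x = F := by
  have hmem : F ∈ (LinearMap.range A).dualCoannihilator.dualAnnihilator :=
    (Submodule.mem_dualAnnihilator F).2 fun y hy =>
      hF y ((Submodule.mem_dualCoannihilator y).1 hy _ ⟨y, rfl⟩)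
  rwa [Subspace.dualCoannihilator_dualAnnihilator_eq] at hmem

variable {K A κ : Type*} [Field K] [CommRing A] [Algebra K A] [Fintype κ]

variable (K) in
/-- The mean of a family of elements of `A` with respect to the weights `b`. -/
def weightedMean (b : κ → A) : (κ → A) →ₗ[K] A :=
  ∑ α, LinearMap.mulLeft K (b α) ∘ₗ LinearMap.proj α

theorem weightedMean_apply (b q : κ → A) : weightedMean K b q = ∑ α, b α * q α := by
  simp [weightedMean]

/-- The covariance of two families of elements of `A` with respect to the weights `b`, integrated
with the functional `I`. -/
def covariance (I : A →ₗ[K] K) (b : κ → A) : (κ → A) →ₗ[K] (κ → A) →ₗ[K] K :=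
  LinearMap.mk₂ K
    (fun q r => I (weightedMean K b (q * r) - weightedMean K b q * weightedMean K b r))
    (fun q q' r => by rw [← map_add, add_mul, map_add, map_add]; ring_nf)
    (fun c q r => by rw [← map_smul, smul_mul_assoc, map_smul, map_smul, smul_mul_assoc, smul_sub])
    (fun q r r' => by rw [← map_add, mul_add, map_add, map_add]; ring_nf)
    (fun c q r => by rw [← map_smul, mul_smul_comm, map_smul, map_smul, mul_smul_comm, smul_sub])

theorem covariance_apply (I : A →ₗ[K] K) (b q r : κ → A) :
    covariance I b q r = I (∑ α, b α * ((q α - ∑ β, b β * q β) * r α)) := by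
  rw [covariance, LinearMap.mk₂_apply]
  simp only [weightedMean_apply, Pi.mul_apply, sub_mul, mul_sub, Finset.sum_sub_distrib,
    Finset.mul_sum, mul_left_comm]

theorem covariance_self {b : κ → A} (hb : ∑ α, b α = 1) (I : A →ₗ[K] K) (q : κ → A) :
    covariance I b q q = I (∑ α, b α * (q α - ∑ β, b β * q β) ^ 2) := by
  set Q := ∑ β, b β * q β with hQ
  have hdev : ∑ α, b α * (q α - Q) = 0 := by
    simp only [mul_sub, Finset.sum_sub_distrib, ← Finset.sum_mul, hb, one_mul, ← hQ, sub_self]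
  rw [covariance_apply, ← hQ, ← sub_eq_zero, ← map_sub, ← Finset.sum_sub_distrib]
  rw [show ∑ α, (b α * ((q α - Q) * q α) - b α * (q α - Q) ^ 2) = (∑ α, b α * (q α - Q)) * Q by
    rw [Finset.sum_mul]; exact Finset.sum_congr rfl fun α _ => by ring, hdev, zero_mul, map_zero]

variable {I : A →ₗ[K] K} {b : κ → A}

theorem sum_mul_repr_eq (hsum : ∑ α, b α = 1) (hli : LinearIndependent K b)
    {r : κ → Submodule.span K (range b)} (hr : ∀ α, (r α : A) = ∑ β, b β * r β) :
    ∑ α, I (b α) * hli.repr (r α) α = I (∑ α, b α * r α) := by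
  rcases isEmpty_or_nonempty κ with _ | ⟨⟨α₀⟩⟩
  · simp
  · have hconst : ∀ α, r α = r α₀ := fun α => Subtype.ext ((hr α).trans (hr α₀).symm)
    have hrepr := hli.linearCombination_repr (r α₀)
    rw [Finsupp.linearCombination_apply, Finsupp.sum_fintype _ _ (by simp)] at hrepr
    simp only [hconst, ← Finset.sum_mul, hsum, one_mul]
    rw [← hrepr, map_sum]
    simp [mul_comm]

variable [DecidableEq κ]

theorem exists_covariance_single_eq (hsum : ∑ α, b α = 1) (hli : LinearIndependent K b)
    (hdef : ∀ a : κ → A, I (∑ α, b α * a α ^ 2) = 0 → a = 0) :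
    ∃ q : κ → A, (∀ α, q α ∈ Submodule.span K (range b)) ∧ ∀ α β,
      covariance I b q (Pi.single α (b β)) = (if α = β then I (b α) else 0) - I (b α * b β) := by
  set W := Submodule.span K (range b)
  have : FiniteDimensional K W := FiniteDimensional.span_of_finite K (finite_range b)
  let inc : (κ → W) →ₗ[K] κ → A := LinearMap.pi fun α => W.subtype ∘ₗ LinearMap.proj α
  let F : (κ → W) →ₗ[K] K :=
    ∑ α, I (b α) • (Finsupp.lapply α ∘ₗ hli.repr ∘ₗ LinearMap.proj α) -
      I ∘ₗ weightedMean K b ∘ₗ inc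
  have hF : ∀ q, F q = ∑ α, I (b α) * hli.repr (q α) α - I (∑ α, b α * q α) := fun q => by
    simp [F, inc, weightedMean_apply]
  obtain ⟨q, hq⟩ : ∃ q, (covariance I b).compl₁₂ inc inc q = F := by
    refine exists_eq_of_forall_isotropic _ _ fun r hr => ?_
    have hdev := congrFun (hdef _ ((covariance_self hsum I _).symm.trans hr))
    rw [hF, sub_eq_zero]
    exact sum_mul_repr_eq hsum hli fun α => sub_eq_zero.1 (hdev α)
  refine ⟨inc q, fun α => (q α).2, fun α β => ?_⟩
  have hβ : b β ∈ W := Submodule.subset_span ⟨β, rfl⟩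
  have hinc : inc (Pi.single α ⟨b β, hβ⟩) = Pi.single α (b β) := by
    ext γ
    rcases eq_or_ne γ α with rfl | hγ <;> simp_all [inc]
  have hqαβ := LinearMap.congr_fun hq (Pi.single α ⟨b β, hβ⟩)
  rw [LinearMap.compl₁₂_apply, hinc, hF] at hqαβ
  rw [hqαβ]
  congr 1
  · rw [Finset.sum_eq_single α (fun γ _ hγ => by simp [hγ]) (by simp)]
    rw [Pi.single_eq_same, hli.repr_eq_single β _ rfl]
    simp [Finsupp.single_apply, eq_comm]
  · rw [Finset.sum_eq_single α (fun γ _ hγ => by simp [hγ]) (by simp), Pi.single_eq_same]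

theorem exists_dual_of_sum_eq_one (hsum : ∑ α, b α = 1) (hli : LinearIndependent K b)
    (hdef : ∀ a : κ → A, I (∑ α, b α * a α ^ 2) = 0 → a = 0) :
    ∃ ζ : κ → A, (∀ α, ζ α ∈ Submodule.span K (range b) * Submodule.span K (range b)) ∧
      (∀ α β, I (b β * (b α * ζ α)) = if α = β then 1 else 0) ∧
      ∑ α, I (b α) • (b α * ζ α) = 1 := by
  have hI : ∀ α, I (b α) ≠ 0 := fun α h => by
    have hsingle := congrFun (hdef (Pi.single α 1) (by simp [Pi.single_apply, ite_pow, h])) α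
    rw [Pi.single_eq_same, Pi.zero_apply] at hsingle
    exact hli.ne_zero (R := K) α (by rw [← mul_one (b α), hsingle, mul_zero])
  obtain ⟨q, hqW, hq⟩ := exists_covariance_single_eq hsum hli hdef
  set W := Submodule.span K (range b)
  set Q := ∑ β, b β * q β with hQ
  have hbW : ∀ α, b α ∈ W := fun α => Submodule.subset_span ⟨α, rfl⟩
  have h1W : (1 : A) ∈ W := hsum ▸ sum_mem fun α _ => hbW α
  refine ⟨fun α => (I (b α))⁻¹ • (q α - Q + 1), fun α => ?_, fun α β => ?_, ?_⟩
  · refine Submodule.smul_mem _ _ (add_mem (sub_mem ?_ ?_) ?_)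
    · simpa using Submodule.mul_mem_mul h1W (hqW α)
    · exact sum_mem fun β _ => Submodule.mul_mem_mul (hbW β) (hqW β)
    · simpa using Submodule.mul_mem_mul h1W h1W
  · have hcov : I (b α * ((q α - Q) * b β)) =
        (if α = β then I (b α) else 0) - I (b α * b β) := by
      rw [← hq, covariance_apply,
        Finset.sum_eq_single α (fun γ _ hγ => by simp [hγ]) (by simp), Pi.single_eq_same]
    have hexpand : b β * (b α * (I (b α))⁻¹ • (q α - Q + 1)) =
        (I (b α))⁻¹ • (b α * ((q α - Q) * b β) + b α * b β) := by
      simp only [mul_smul_comm]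
      ring_nf
    rw [hexpand, map_smul, map_add, hcov, sub_add_cancel, smul_ite, smul_zero, smul_eq_mul,
      inv_mul_cancel₀ (hI α)]
  · simp only [mul_smul_comm, smul_inv_smul₀ (hI _), mul_add, mul_sub, Finset.sum_add_distrib,
      Finset.sum_sub_distrib, ← Finset.sum_mul, hsum, one_mul, ← hQ, sub_self, zero_add]

end DualBasis

section Bernstein

open MvPolynomial

variable {ι : Type*} [Fintype ι]

/-- The Bernstein polynomial `|α|! / α! λ^α`, as a polynomial in the barycentric coordinates. -/
def bernPoly (α : ι → ℕ) : MvPolynomial ι ℝ :=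
  monomial (Finsupp.equivFunOnFinite.symm α)
    ((Nat.factorial (∑ j, α j) : ℝ) / ∏ j, (Nat.factorial (α j) : ℝ))

theorem bernPoly_coeff_pos (α : ι → ℕ) :
    0 < (Nat.factorial (∑ j, α j) : ℝ) / ∏ j, (Nat.factorial (α j) : ℝ) :=
  div_pos (mod_cast Nat.factorial_pos _)
    (Finset.prod_pos fun _ _ => mod_cast Nat.factorial_pos _)

theorem eval_bernPoly (α : ι → ℕ) (x : ι → ℝ) :
    eval x (bernPoly α) =
      (Nat.factorial (∑ j, α j) : ℝ) / (∏ j, (Nat.factorial (α j) : ℝ)) * ∏ j, x j ^ α j := by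
  rw [bernPoly, eval_monomial, Finsupp.prod_fintype _ _ fun _ => pow_zero _]
  simp only [Finsupp.equivFunOnFinite_symm_apply_apply]

theorem isHomogeneous_bernPoly {k : ℕ} {α : ι → ℕ} (hα : ∑ j, α j = k) :
    (bernPoly α).IsHomogeneous k :=
  isHomogeneous_monomial _ (by simp [Finsupp.degree_eq_sum, hα])

theorem eval_bernPoly_nonneg (α : ι → ℕ) {x : ι → ℝ} (hx : ∀ j, 0 ≤ x j) :
    0 ≤ eval x (bernPoly α) := by
  rw [eval_bernPoly]
  exact mul_nonneg (bernPoly_coeff_pos α).le (Finset.prod_nonneg fun j _ => pow_nonneg (hx j) _)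

theorem eval_bernPoly_pos (α : ι → ℕ) {x : ι → ℝ} (hx : ∀ j, 0 < x j) :
    0 < eval x (bernPoly α) := by
  rw [eval_bernPoly]
  exact mul_pos (bernPoly_coeff_pos α) (Finset.prod_pos fun j _ => pow_pos (hx j) _)

theorem rename_bernPoly_comp (σ : Equiv.Perm ι) (α : ι → ℕ) :
    rename σ (bernPoly (α ∘ σ)) = bernPoly α := by
  refine MvPolynomial.funext fun x => ?_
  simp only [eval_rename, eval_bernPoly, Function.comp_apply]
  rw [Equiv.sum_comp σ α, Equiv.prod_comp σ fun j => (Nat.factorial (α j) : ℝ),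
    Equiv.prod_comp σ fun j => x j ^ α j]

theorem linearIndependent_bernPoly : LinearIndependent ℝ (bernPoly (ι := ι)) := by
  have hmon : LinearIndependent ℝ fun α : ι → ℕ =>
      monomial (R := ℝ) (Finsupp.equivFunOnFinite.symm α) 1 := by
    simpa only [Function.comp_def, coe_basisMonomials] using
      (basisMonomials ι ℝ).linearIndependent.comp _ Finsupp.equivFunOnFinite.symm.injective
  have hunits := hmon.units_smul fun α => Units.mk0 _ (bernPoly_coeff_pos α).ne'
  refine (funext fun α => ?_ : _ = bernPoly (ι := ι)) ▸ hunits
  simp [bernPoly, Units.smul_def, smul_monomial]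

variable (ι) in
/-- The open standard simplex. -/
def openSimplex : Set (ι → ℝ) := {x | (∀ j, 0 < x j) ∧ ∑ j, x j = 1}

theorem openSimplex_subset_stdSimplex : openSimplex ι ⊆ stdSimplex ℝ ι :=
  fun _ hx => ⟨fun j => (hx.1 j).le, hx.2⟩

theorem const_mem_openSimplex [Nonempty ι] :
    (fun _ => (Fintype.card ι : ℝ)⁻¹) ∈ openSimplex ι :=
  ⟨fun _ => inv_pos.2 (mod_cast Fintype.card_pos), by simp⟩

theorem stdSimplex_subset_closure_openSimplex [Nonempty ι] :
    stdSimplex ℝ ι ⊆ closure (openSimplex ι) := by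
  intro x hx
  set c : ι → ℝ := fun _ => (Fintype.card ι : ℝ)⁻¹
  have hc : c ∈ openSimplex ι := const_mem_openSimplex
  have hmaps : MapsTo (AffineMap.lineMap x c : ℝ → ι → ℝ) (Ioo 0 1) (openSimplex ι) := by
    intro t ht
    refine ⟨fun j => ?_, ?_⟩
    · have := mul_nonneg (sub_nonneg.2 ht.2.le) (hx.1 j)
      have := mul_pos ht.1 (hc.1 j)
      simp only [AffineMap.lineMap_apply_module, Pi.add_apply, Pi.smul_apply, smul_eq_mul]
      linarith
    · simp only [AffineMap.lineMap_apply_module, Pi.add_apply, Pi.smul_apply, smul_eq_mul,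
        Finset.sum_add_distrib, ← Finset.mul_sum, hx.2, hc.2]
      ring
  have hcl := map_mem_closure (AffineMap.lineMap_continuous (p := x) (q := c)) (x := 0)
    (by rw [closure_Ioo zero_ne_one]; exact left_mem_Icc.2 zero_le_one) hmaps
  rwa [AffineMap.lineMap_apply_zero] at hcl

theorem eval_eq_on_stdSimplex [Nonempty ι] {p q : MvPolynomial ι ℝ}
    (h : ∀ x ∈ openSimplex ι, eval x p = eval x q) : ∀ x ∈ stdSimplex ℝ ι, eval x p = eval x q :=
  fun _ hx => (isClosed_eq (continuous_eval p) (continuous_eval q)).closure_subset_iff.2 h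
    (stdSimplex_subset_closure_openSimplex hx)

theorem eval_smul_of_isHomogeneous {R σ : Type*} [CommSemiring R] {k : ℕ} {p : MvPolynomial σ R}
    (hp : p.IsHomogeneous k) (c : R) (x : σ → R) : eval (c • x) p = c ^ k * eval x p := by
  rw [eval_eq, eval_eq, Finset.mul_sum]
  refine Finset.sum_congr rfl fun α hα => ?_
  have hdeg : ∑ j ∈ α.support, α j = k := by
    rw [← Finsupp.degree_apply, Finsupp.degree_eq_weight_one]
    exact hp (mem_support_iff.1 hα)
  simp only [Pi.smul_apply, smul_eq_mul, mul_pow, Finset.prod_mul_distrib,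
    Finset.prod_pow_eq_pow_sum, hdeg, mul_left_comm]

theorem eq_zero_of_isHomogeneous_of_eval_eq_zero [Nonempty ι] {k : ℕ} {p : MvPolynomial ι ℝ}
    (hp : p.IsHomogeneous k) (h : ∀ x ∈ openSimplex ι, eval x p = 0) : p = 0 := by
  refine funext_set (fun _ => Ioi (0 : ℝ)) (fun _ => Ioi_infinite 0) fun x hx => ?_
  have hx' : ∀ j, 0 < x j := fun j => hx j (mem_univ j)
  set s := ∑ j, x j
  have hs : 0 < s := Finset.sum_pos (fun j _ => hx' j) Finset.univ_nonempty
  have hmem : s⁻¹ • x ∈ openSimplex ι := by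
    refine ⟨fun j => mul_pos (inv_pos.2 hs) (hx' j), ?_⟩
    simp only [Pi.smul_apply, smul_eq_mul, ← Finset.mul_sum]
    exact inv_mul_cancel₀ hs.ne'
  rw [map_zero, ← smul_inv_smul₀ hs.ne' x, eval_smul_of_isHomogeneous hp, h _ hmem, mul_zero]

theorem sum_eval_bernPoly [DecidableEq ι] (k : ℕ) {x : ι → ℝ} (hx : ∑ j, x j = 1) :
    ∑ α ∈ Finset.univ.piAntidiag k, eval x (bernPoly α) = 1 := by
  have h := Finset.sum_pow_eq_sum_piAntidiag (Finset.univ : Finset ι) x k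
  rw [hx, one_pow] at h
  rw [h]
  refine Finset.sum_congr rfl fun α _ => ?_
  rw [eval_bernPoly]
  congr 1
  have hp : (∏ j, (Nat.factorial (α j) : ℝ)) ≠ 0 :=
    Finset.prod_ne_zero_iff.2 fun j _ => mod_cast Nat.factorial_ne_zero _
  rw [div_eq_iff hp, mul_comm]
  exact_mod_cast (Nat.multinomial_spec Finset.univ α).symm

end Bernstein

section LocalDualBasis

open MvPolynomial

variable {ι : Type*} [Fintype ι]

/-- A functional on polynomials in the barycentric coordinates that, like an integral over the
simplex, is nonnegative on nonnegative functions and vanishes only on the zero function among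
them. -/
structure IsStrictlyPositive (I : MvPolynomial ι ℝ →ₗ[ℝ] ℝ) : Prop where
  nonneg : ∀ p, (∀ x ∈ stdSimplex ℝ ι, 0 ≤ eval x p) → 0 ≤ I p
  eq_zero : ∀ p, (∀ x ∈ stdSimplex ℝ ι, 0 ≤ eval x p) → I p = 0 →
    ∀ x ∈ stdSimplex ℝ ι, eval x p = 0

variable {I : MvPolynomial ι ℝ →ₗ[ℝ] ℝ}

theorem IsStrictlyPositive.eq_zero_of_eval_eq_zero (hI : IsStrictlyPositive I)
    {p : MvPolynomial ι ℝ} (hp : ∀ x ∈ stdSimplex ℝ ι, eval x p = 0) : I p = 0 := by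
  have hneg := hI.nonneg (-p) fun x hx => by rw [map_neg, hp x hx, neg_zero]
  rw [map_neg] at hneg
  exact le_antisymm (neg_nonneg.1 hneg) (hI.nonneg p fun x hx => (hp x hx).ge)

variable (ι) in
/-- The algebra of polynomial functions on the open simplex. -/
abbrev SimplexPoly : Type _ := MvPolynomial ι ℝ ⧸ vanishingIdeal ℝ (openSimplex ι)

variable (ι) in
/-- The polynomial function on the open simplex that is defined by a polynomial. -/
abbrev toSimplexPoly : MvPolynomial ι ℝ →ₐ[ℝ] SimplexPoly ι := Ideal.Quotient.mkₐ ℝ _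

theorem toSimplexPoly_surjective : Function.Surjective (toSimplexPoly ι) :=
  Ideal.Quotient.mkₐ_surjective ℝ _

theorem toSimplexPoly_eq_iff {p q : MvPolynomial ι ℝ} :
    toSimplexPoly ι p = toSimplexPoly ι q ↔ ∀ x ∈ openSimplex ι, eval x p = eval x q := by
  simp [toSimplexPoly, Ideal.Quotient.mk_eq_mk_iff_sub_mem, mem_vanishingIdeal_iff, sub_eq_zero]

theorem toSimplexPoly_eq_zero_iff {p : MvPolynomial ι ℝ} :
    toSimplexPoly ι p = 0 ↔ ∀ x ∈ openSimplex ι, eval x p = 0 := by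
  simpa using toSimplexPoly_eq_iff (p := p) (q := 0)

theorem IsStrictlyPositive.exists_toSimplexPoly [Nonempty ι] (hI : IsStrictlyPositive I) :
    ∃ J : SimplexPoly ι →ₗ[ℝ] ℝ, ∀ p, J (toSimplexPoly ι p) = I p := by
  obtain ⟨s, hs⟩ := (toSimplexPoly ι).toLinearMap.exists_rightInverse_of_surjective
    (LinearMap.range_eq_top.2 toSimplexPoly_surjective)
  refine ⟨I ∘ₗ s, fun p => sub_eq_zero.1 ?_⟩
  rw [LinearMap.comp_apply, ← map_sub]
  refine hI.eq_zero_of_eval_eq_zero fun x hx => ?_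
  rw [map_sub, sub_eq_zero]
  exact eval_eq_on_stdSimplex (toSimplexPoly_eq_iff.1 (LinearMap.congr_fun hs _)) x hx

theorem linearIndependent_toSimplexPoly_bernPoly [Nonempty ι] {k : ℕ} {S : Set (ι → ℕ)}
    (hS : ∀ α ∈ S, ∑ j, α j = k) :
    LinearIndependent ℝ fun α : S => toSimplexPoly ι (bernPoly α.1) := by
  have hker : Disjoint (Submodule.span ℝ (range fun α : S => bernPoly α.1))
      (LinearMap.ker (toSimplexPoly ι).toLinearMap) := by
    refine Submodule.disjoint_def.2 fun p hp h0 => ?_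
    have hle : Submodule.span ℝ (range fun α : S => bernPoly α.1) ≤ homogeneousSubmodule ι ℝ k :=
      Submodule.span_le.2 (range_subset_iff.2 fun α => isHomogeneous_bernPoly (hS α α.2))
    exact eq_zero_of_isHomogeneous_of_eval_eq_zero (hle hp) (toSimplexPoly_eq_zero_iff.1 h0)
  exact (linearIndependent_bernPoly.comp _ Subtype.val_injective).map hker

theorem IsStrictlyPositive.eq_zero_of_sum_bernPoly_mul_sq [Nonempty ι] (hI : IsStrictlyPositive I)
    {κ : Type*} [Fintype κ] {α : κ → ι → ℕ} {p : κ → MvPolynomial ι ℝ}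
    (h : I (∑ c, bernPoly (α c) * p c ^ 2) = 0) (c : κ) : toSimplexPoly ι (p c) = 0 := by
  have hnonneg : ∀ x ∈ stdSimplex ℝ ι, ∀ c, 0 ≤ eval x (bernPoly (α c) * p c ^ 2) :=
    fun x hx c => by
      rw [map_mul, map_pow]
      exact mul_nonneg (eval_bernPoly_nonneg _ hx.1) (sq_nonneg _)
  refine toSimplexPoly_eq_zero_iff.2 fun x hx => ?_
  have hx' := openSimplex_subset_stdSimplex hx
  have hzero := hI.eq_zero _ (fun x hx => by
    rw [map_sum]; exact Finset.sum_nonneg fun c _ => hnonneg x hx c) h x hx'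
  rw [map_sum, Finset.sum_eq_zero_iff_of_nonneg fun c _ => hnonneg x hx' c] at hzero
  have hc := hzero c (Finset.mem_univ c)
  rw [map_mul, map_pow] at hc
  exact pow_eq_zero_iff two_ne_zero |>.1
    ((mul_eq_zero.1 hc).resolve_left (eval_bernPoly_pos _ hx.1).ne')

theorem exists_isHomogeneous_of_mem_span_mul_span {k : ℕ} {S : Set (ι → ℕ)}
    (hS : ∀ α ∈ S, ∑ j, α j = k) {ζ : SimplexPoly ι}
    (hζ : ζ ∈ Submodule.span ℝ (range fun α : S => toSimplexPoly ι (bernPoly α.1)) *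
      Submodule.span ℝ (range fun α : S => toSimplexPoly ι (bernPoly α.1))) :
    ∃ p : MvPolynomial ι ℝ, p.IsHomogeneous (k + k) ∧ toSimplexPoly ι p = ζ := by
  have hle : Submodule.span ℝ (range fun α : S => toSimplexPoly ι (bernPoly α.1)) ≤
      (homogeneousSubmodule ι ℝ k).map (toSimplexPoly ι).toLinearMap :=
    Submodule.span_le.2 <| range_subset_iff.2 fun α =>
      ⟨bernPoly α, isHomogeneous_bernPoly (hS α α.2), rfl⟩
  have hmem := mul_le_mul' hle hle hζ
  rw [← Submodule.map_mul] at hmem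
  obtain ⟨p, hp, rfl⟩ := hmem
  exact ⟨p, homogeneousSubmodule_mul k k hp, rfl⟩

variable [DecidableEq ι]

/-- The polynomials `Z α`, `|α| = k`, times the Bernstein polynomials `b_α`, form a basis dual to
the Bernstein polynomials that has the degree and the mass required by the global construction. -/
structure IsLocalDualBasis (I : MvPolynomial ι ℝ →ₗ[ℝ] ℝ) (k : ℕ)
    (Z : (ι → ℕ) → MvPolynomial ι ℝ) : Prop where
  totalDegree_le : ∀ α ∈ Finset.univ.piAntidiag k, (Z α).totalDegree ≤ 2 * k
  biorthogonal : ∀ α ∈ Finset.univ.piAntidiag k, ∀ β ∈ Finset.univ.piAntidiag k,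
    I (bernPoly β * (bernPoly α * Z α)) = if α = β then 1 else 0
  mass : ∀ x ∈ stdSimplex ℝ ι, ∑ α ∈ Finset.univ.piAntidiag k,
    I (bernPoly α) * (eval x (bernPoly α) * eval x (Z α)) = 1

theorem sum_toSimplexPoly_bernPoly (k : ℕ) :
    ∑ α : (Finset.univ.piAntidiag k : Finset (ι → ℕ)), toSimplexPoly ι (bernPoly α.1) = 1 := by
  rw [← map_one (toSimplexPoly ι), ← map_sum, toSimplexPoly_eq_iff]
  intro x hx
  rw [map_sum, map_one, ← sum_eval_bernPoly k hx.2]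
  exact Finset.sum_coe_sort _ fun α => eval x (bernPoly α)

theorem exists_isLocalDualBasis [Nonempty ι] (hI : IsStrictlyPositive I) (k : ℕ) :
    ∃ Z, IsLocalDualBasis I k Z := by
  let κ := (Finset.univ.piAntidiag k : Finset (ι → ℕ))
  let π := toSimplexPoly ι
  let b : κ → SimplexPoly ι := fun α => π (bernPoly α.1)
  have hdeg : ∀ α ∈ κ, ∑ j, α j = k := fun α hα => (Finset.mem_piAntidiag.1 hα).1
  obtain ⟨J, hJ⟩ := hI.exists_toSimplexPoly
  have hdef : ∀ a : κ → SimplexPoly ι, J (∑ α, b α * a α ^ 2) = 0 → a = 0 := fun a ha => by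
    choose p hp using fun α => toSimplexPoly_surjective (a α)
    simp only [← hp, b, π, ← map_pow, ← map_mul, ← map_sum, hJ] at ha
    exact funext fun α => (hp α).symm.trans (hI.eq_zero_of_sum_bernPoly_mul_sq ha α)
  obtain ⟨ζ, hζ, hdual, hmass⟩ := exists_dual_of_sum_eq_one (sum_toSimplexPoly_bernPoly k)
    (linearIndependent_toSimplexPoly_bernPoly hdeg) hdef
  choose Z hZhom hZ using fun α => exists_isHomogeneous_of_mem_span_mul_span hdeg (hζ α)
  have hext : ∀ α : κ, Subtype.val.extend Z 0 α.1 = Z α :=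
    Subtype.val_injective.extend_apply Z 0
  refine ⟨Subtype.val.extend Z 0, fun α hα => ?_, fun α hα β hβ => ?_, ?_⟩
  · rw [hext ⟨α, hα⟩, two_mul]
    exact (hZhom _).totalDegree_le
  · rw [hext ⟨α, hα⟩, ← hJ, map_mul (toSimplexPoly ι), map_mul (toSimplexPoly ι), hZ,
      hdual ⟨α, hα⟩ ⟨β, hβ⟩]
    simp only [Subtype.mk.injEq]
  · have hpoly : π (∑ α : κ, I (bernPoly α.1) • (bernPoly α.1 * Z α)) = π 1 := by
      simp only [π, map_sum, map_smul, map_mul, hZ, ← hJ]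
      exact hmass.trans (map_one _).symm
    intro x hx
    have heval := eval_eq_on_stdSimplex (toSimplexPoly_eq_iff.1 hpoly) x hx
    rw [map_sum, map_one] at heval
    rw [← heval, ← Finset.sum_coe_sort]
    exact Finset.sum_congr rfl fun α _ => by rw [hext α, smul_eval, map_mul]

/-- A family of polynomials indexed by multi-indices is equivariant if it is compatible with
relabelling the vertices of the simplex. -/
def IsEquivariant (Z : (ι → ℕ) → MvPolynomial ι ℝ) : Prop :=
  ∀ (σ : Equiv.Perm ι) α, rename σ (Z (α ∘ σ)) = Z α

theorem comp_perm_mem_piAntidiag {k : ℕ} {α : ι → ℕ} (σ : Equiv.Perm ι) :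
    α ∘ σ ∈ Finset.univ.piAntidiag k ↔ α ∈ Finset.univ.piAntidiag k := by
  simp only [Finset.mem_piAntidiag, Finset.mem_univ, implies_true, and_true, Function.comp_apply,
    Equiv.sum_comp σ α]

theorem IsLocalDualBasis.permute {k : ℕ} {Z : (ι → ℕ) → MvPolynomial ι ℝ}
    (hZ : IsLocalDualBasis I k Z) (hI : ∀ (σ : Equiv.Perm ι) p, I (rename σ p) = I p)
    (σ : Equiv.Perm ι) : IsLocalDualBasis I k fun α => rename σ (Z (α ∘ σ)) where
  totalDegree_le α hα :=
    (totalDegree_rename_le _ _).trans (hZ.totalDegree_le _ ((comp_perm_mem_piAntidiag σ).2 hα))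
  biorthogonal α hα β hβ := by
    rw [← rename_bernPoly_comp σ α, ← rename_bernPoly_comp σ β, ← map_mul, ← map_mul, hI,
      hZ.biorthogonal _ ((comp_perm_mem_piAntidiag σ).2 hα) _
        ((comp_perm_mem_piAntidiag σ).2 hβ)]
    simp only [σ.surjective.injective_comp_right.eq_iff]
  mass x hx := by
    have hxσ : x ∘ σ ∈ stdSimplex ℝ ι := ⟨fun j => hx.1 _, (Equiv.sum_comp σ x).trans hx.2⟩
    rw [← hZ.mass _ hxσ]
    refine Finset.sum_equiv (σ.symm.arrowCongr (Equiv.refl ℕ))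
      (fun α => (comp_perm_mem_piAntidiag σ).symm) fun α _ => ?_
    change _ = I (bernPoly (α ∘ σ)) * (_ * eval (x ∘ σ) (Z (α ∘ σ)))
    rw [← rename_bernPoly_comp σ α, hI, eval_rename, eval_rename]
    rfl

theorem IsLocalDualBasis.average {k : ℕ} {κ : Type*} [Fintype κ] [Nonempty κ]
    {Z : κ → (ι → ℕ) → MvPolynomial ι ℝ} (hZ : ∀ c, IsLocalDualBasis I k (Z c)) :
    IsLocalDualBasis I k fun α => (Fintype.card κ : ℝ)⁻¹ • ∑ c, Z c α := by
  have hκ : (Fintype.card κ : ℝ)⁻¹ * Fintype.card κ = 1 :=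
    inv_mul_cancel₀ (mod_cast Fintype.card_ne_zero)
  refine ⟨fun α hα => ?_, fun α hα β hβ => ?_, fun x hx => ?_⟩
  · exact (totalDegree_smul_le _ _).trans
      (totalDegree_finsetSum_le fun c _ => (hZ c).totalDegree_le α hα)
  · simp only [mul_smul_comm, Finset.mul_sum, map_smul, map_sum, (hZ _).biorthogonal α hα β hβ,
      Finset.sum_const, Finset.card_univ, nsmul_eq_mul, smul_eq_mul]
    rw [← mul_assoc, hκ, one_mul]
  · calc _ = (Fintype.card κ : ℝ)⁻¹ * ∑ c, ∑ α ∈ Finset.univ.piAntidiag k,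
          I (bernPoly α) * (eval x (bernPoly α) * eval x (Z c α)) := by
          rw [Finset.sum_comm]
          simp only [smul_eval, map_sum, Finset.mul_sum, mul_left_comm]
      _ = 1 := by simp only [(hZ _).mass x hx, Finset.sum_const, Finset.card_univ, nsmul_one, hκ]

theorem exists_isEquivariant_isLocalDualBasis [Nonempty ι] (hI : IsStrictlyPositive I)
    (hperm : ∀ (σ : Equiv.Perm ι) p, I (rename σ p) = I p) (k : ℕ) :
    ∃ Z, IsLocalDualBasis I k Z ∧ IsEquivariant Z := by
  obtain ⟨Z, hZ⟩ := exists_isLocalDualBasis hI k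
  refine ⟨_, IsLocalDualBasis.average fun σ => hZ.permute hperm σ, fun τ α => ?_⟩
  simp only [map_smul, map_sum, rename_rename]
  exact congrArg _ (Equiv.sum_comp (Equiv.mulLeft τ) fun σ => rename σ (Z (α ∘ σ)))

end LocalDualBasis

section BarycentricIntegral

section AffineInvariance

variable {E F : Type*} [NormedAddCommGroup E] [NormedSpace ℝ E] [FiniteDimensional ℝ E]
  [MeasurableSpace E] [BorelSpace E] (μ : Measure E) [μ.IsAddHaarMeasure]
  [NormedAddCommGroup F] [NormedSpace ℝ F] {A : E →ᵃ[ℝ] E} {S : Set E}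

theorem setIntegral_image_affineMap (hA : Function.Injective A) (hS : MeasurableSet S)
    (f : E → F) : ∫ x in A '' S, f x ∂μ = |A.linear.det| • ∫ x in S, f (A x) ∂μ := by
  have hderiv (x : E) (_ : x ∈ S) :
      HasFDerivWithinAt A A.linear.toContinuousLinearMap S x :=
    (⟨A, A.continuous_of_finiteDimensional⟩ : E →ᴬ[ℝ] E).hasFDerivWithinAt
  rw [integral_image_eq_integral_abs_det_fderiv_smul μ hS hderiv hA.injOn, integral_smul,
    LinearMap.det_toContinuousLinearMap]

theorem setAverage_image_affineMap (hA : Function.Injective A) (hS : MeasurableSet S)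
    (f : E → F) : ⨍ x in A '' S, f x ∂μ = ⨍ x in S, f (A x) ∂μ := by
  have hdet : |A.linear.det| ≠ 0 := abs_ne_zero.2 <| mt LinearMap.det_eq_zero_iff_ker_ne_bot.1 <|
    not_not.2 <| LinearMap.ker_eq_bot.2 <| A.linear_injective_iff.2 hA
  have hvol : μ.real (A '' S) = |A.linear.det| * μ.real S := by
    simpa using setIntegral_image_affineMap μ hA hS fun _ => (1 : ℝ)
  rw [setAverage_eq, setAverage_eq, setIntegral_image_affineMap μ hA hS, hvol, smul_smul,
    mul_inv_rev, inv_mul_cancel_right₀ hdet]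

end AffineInvariance

variable {d : ℕ} {ι : Type*}

theorem coords_mem_stdSimplex [Fintype ι] (b : AffineBasis ι ℝ (Eu d)) {x : Eu d}
    (hx : x ∈ convexHull ℝ (range b)) : b.coords x ∈ stdSimplex ℝ ι := by
  rw [b.convexHull_eq_nonneg_coord] at hx
  exact ⟨fun j => hx j, b.sum_coord_apply_eq_one x⟩

theorem coords_sum_smul [Fintype ι] (b : AffineBasis ι ℝ (Eu d)) {w : ι → ℝ} (hw : ∑ j, w j = 1) :
    b.coords (∑ j, w j • b j) = w := by
  ext j
  rw [← Finset.affineCombination_eq_linear_combination _ _ _ hw]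
  exact b.coord_apply_combination_of_mem (Finset.mem_univ j) hw

theorem continuous_coords [Finite ι] (b : AffineBasis ι ℝ (Eu d)) : Continuous b.coords :=
  have := Fintype.ofFinite ι
  AffineMap.continuous_of_finiteDimensional _

theorem isCompact_hull [Finite ι] (b : AffineBasis ι ℝ (Eu d)) :
    IsCompact (convexHull ℝ (range b)) :=
  (finite_range b).isCompact_convexHull ℝ

theorem hull_volume_pos [Finite ι] (b : AffineBasis ι ℝ (Eu d)) :
    0 < volume.real (convexHull ℝ (range b)) := by
  refine ENNReal.toReal_pos (ne_of_gt ?_) (isCompact_hull b).measure_ne_top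
  exact Measure.measure_pos_of_nonempty_interior _
    (interior_convexHull_nonempty_iff_affineSpan_eq_top.2 b.tot)

theorem setAverage_hull_comp_coords [Finite ι] (b₀ b : AffineBasis ι ℝ (Eu d))
    (F : (ι → ℝ) → ℝ) :
    ⨍ x in convexHull ℝ (range b), F (b.coords x) =
      ⨍ x in convexHull ℝ (range b₀), F (b₀.coords x) := by
  cases nonempty_fintype ι
  let A : Eu d →ᵃ[ℝ] Eu d := (Fintype.linearCombination ℝ b).toAffineMap.comp b₀.coords
  have hcoords (x : Eu d) : b.coords (A x) = b₀.coords x :=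
    coords_sum_smul b (b₀.sum_coord_apply_eq_one x)
  have hA (j : ι) : A (b₀ j) = b j := by
    classical
    simp [A, Fintype.linearCombination_apply, AffineBasis.coord_apply]
  have hinj : Function.Injective A := fun x y hxy => by
    refine b₀.ext_elem fun j => ?_
    rw [← b₀.coords_apply, ← b₀.coords_apply, ← hcoords, hxy, hcoords]
  have hrange : A '' range b₀ = range b := by
    rw [← range_comp]
    exact congrArg range (funext hA)
  rw [← hrange, ← AffineMap.image_convexHull,
    setAverage_image_affineMap volume hinj (isCompact_hull b₀).measurableSet]
  simp only [hcoords]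

/-- A chosen reference simplex. -/
def refBasis (d : ℕ) : AffineBasis (Fin (d + 1)) ℝ (Eu d) :=
  (AffineBasis.exists_affineBasis_of_finiteDimensional (by simp)).some

theorem continuous_eval_coords [Finite ι] (b : AffineBasis ι ℝ (Eu d)) (p : MvPolynomial ι ℝ) :
    Continuous fun x => MvPolynomial.eval (b.coords x) p :=
  (MvPolynomial.continuous_eval p).comp (continuous_coords b)

theorem integrableOn_eval_coords [Finite ι] (b : AffineBasis ι ℝ (Eu d)) (p : MvPolynomial ι ℝ) :
    IntegrableOn (fun x => MvPolynomial.eval (b.coords x) p) (convexHull ℝ (range b)) :=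
  (continuous_eval_coords b p).continuousOn.integrableOn_compact (isCompact_hull b)

/-- The mean value over the reference simplex of a polynomial in barycentric coordinates; by
affine invariance, this is its mean value over any simplex. -/
def refMean (d : ℕ) : MvPolynomial (Fin (d + 1)) ℝ →ₗ[ℝ] ℝ where
  toFun p := ⨍ x in convexHull ℝ (range (refBasis d)), MvPolynomial.eval ((refBasis d).coords x) p
  map_add' p q := by
    simp only [setAverage_eq, map_add]
    rw [integral_add (integrableOn_eval_coords _ p) (integrableOn_eval_coords _ q), smul_add]
  map_smul' c p := by
    simp only [setAverage_eq, MvPolynomial.smul_eval, RingHom.id_apply, smul_eq_mul,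
      integral_const_mul, mul_left_comm]

theorem setAverage_hull_eval_coords (b : AffineBasis (Fin (d + 1)) ℝ (Eu d))
    (p : MvPolynomial (Fin (d + 1)) ℝ) :
    ⨍ x in convexHull ℝ (range b), MvPolynomial.eval (b.coords x) p = refMean d p :=
  setAverage_hull_comp_coords (refBasis d) b fun y => MvPolynomial.eval y p

theorem integral_hull_eval_coords (b : AffineBasis (Fin (d + 1)) ℝ (Eu d))
    (p : MvPolynomial (Fin (d + 1)) ℝ) :
    ∫ x in convexHull ℝ (range b), MvPolynomial.eval (b.coords x) p =
      volume.real (convexHull ℝ (range b)) * refMean d p := by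
  rw [← setAverage_hull_eval_coords b, setAverage_eq, smul_eq_mul,
    mul_inv_cancel_left₀ (hull_volume_pos b).ne']

theorem eval_coords_eq_zero_of_integral_eq_zero [Fintype ι] (b : AffineBasis ι ℝ (Eu d))
    {p : MvPolynomial ι ℝ} (hp : ∀ x ∈ stdSimplex ℝ ι, 0 ≤ MvPolynomial.eval x p)
    (h : ∫ x in convexHull ℝ (range b), MvPolynomial.eval (b.coords x) p = 0) {x : Eu d}
    (hx : x ∈ interior (convexHull ℝ (range b))) : MvPolynomial.eval (b.coords x) p = 0 := by
  rw [setIntegral_eq_zero_iff_of_nonneg_ae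
    ((ae_restrict_iff' (isCompact_hull b).measurableSet).2
      (ae_of_all _ fun y hy => hp _ (coords_mem_stdSimplex b hy)))
    (integrableOn_eval_coords b p)] at h
  exact Measure.eqOn_open_of_ae_eq (ae_restrict_of_ae_restrict_of_subset interior_subset h)
    isOpen_interior (continuous_eval_coords b p).continuousOn continuousOn_const hx

theorem isStrictlyPositive_refMean (d : ℕ) : IsStrictlyPositive (refMean d) where
  nonneg p hp := by
    rw [← setAverage_hull_eval_coords (refBasis d), setAverage_eq]
    exact smul_nonneg (inv_nonneg.2 measureReal_nonneg) <| setIntegral_nonneg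
      (isCompact_hull _).measurableSet fun _ hx => hp _ (coords_mem_stdSimplex _ hx)
  eq_zero p hp h := by
    let b := refBasis d
    have hint : ∫ x in convexHull ℝ (range b), MvPolynomial.eval (b.coords x) p = 0 := by
      rw [integral_hull_eval_coords, h, mul_zero]
    intro x hx
    rw [← map_zero (MvPolynomial.eval x)]
    refine eval_eq_on_stdSimplex (fun y hy => ?_) x hx
    have hcoords : b.coords (∑ j, y j • b j) = y := coords_sum_smul b hy.2
    rw [map_zero, ← hcoords]
    refine eval_coords_eq_zero_of_integral_eq_zero b hp hint ?_
    rw [b.interior_convexHull]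
    exact fun j => (hy.1 j).trans_eq (congrFun hcoords j).symm

theorem refMean_rename (σ : Equiv.Perm (Fin (d + 1))) (p : MvPolynomial (Fin (d + 1)) ℝ) :
    refMean d (MvPolynomial.rename σ p) = refMean d p := by
  have hrange : range ((refBasis d).reindex σ.symm) = range (refBasis d) := by
    rw [AffineBasis.coe_reindex]
    exact σ.surjective.range_comp _
  have hcoords (x : Eu d) :
      ((refBasis d).reindex σ.symm).coords x = (refBasis d).coords x ∘ σ := by
    ext j
    simp
  rw [← setAverage_hull_eval_coords ((refBasis d).reindex σ.symm) p, hrange]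
  simp only [hcoords, ← MvPolynomial.eval_rename]
  rfl

end BarycentricIntegral

section FiniteFamilies

open scoped NNReal

variable {κ X : Type*} {K : Set X}

theorem exists_norm_le_of_continuousOn {F : Type*} [TopologicalSpace X] [SeminormedAddCommGroup F]
    {s : Finset κ} {f : κ → X → F} (hK : IsCompact K) (hf : ∀ a ∈ s, ContinuousOn (f a) K) :
    ∃ B, ∀ a ∈ s, ∀ x ∈ K, ‖f a x‖ ≤ B := by
  choose! B hB using fun a ha => hK.exists_bound_of_continuousOn (hf a ha)
  have hev : ∀ᶠ b in Filter.atTop, ∀ a ∈ s, B a ≤ b :=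
    (Filter.eventually_all_finset s).2 fun a _ => Filter.eventually_ge_atTop (B a)
  exact hev.exists.imp fun b hb a ha x hx => (hB a ha x hx).trans (hb a ha)

theorem exists_lipschitzOnWith_of_forall {Y : Type*} [PseudoEMetricSpace X] [PseudoEMetricSpace Y]
    {s : Finset κ} {f : κ → X → Y} {S : κ → Set X}
    (hf : ∀ a ∈ s, ∃ L, LipschitzOnWith L (f a) (S a)) :
    ∃ L, ∀ a ∈ s, LipschitzOnWith L (f a) (S a) := by
  choose! L hL using hf
  exact ⟨s.sup L, fun a ha => (hL a ha).weaken (Finset.le_sup ha)⟩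

end FiniteFamilies

section PiecewiseLipschitz

open scoped NNReal

variable {κ X : Type*} [Finite κ] [PseudoMetricSpace X] {K : ℝ≥0}

theorem dist_le_of_finite_closed_cover_Icc {S : κ → Set ℝ} {f : ℝ → X} {a b : ℝ} (hab : a ≤ b)
    (hS : ∀ i, IsClosed (S i)) (hcov : Icc a b ⊆ ⋃ i, S i) (hf : ∀ i, LipschitzOnWith K f (S i)) :
    dist (f b) (f a) ≤ K * (b - a) := by
  have hcont : ContinuousOn f (Icc a b) :=
    ((locallyFinite_of_finite S).continuousOn_iUnion hS fun i => (hf i).continuousOn).mono hcov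
  have hsub : Icc a b ⊆ {t | dist (f t) (f a) ≤ K * (t - a)} := by
    refine IsClosed.Icc_subset_of_forall_exists_gt ?_ (by simp) ?_
    · have hdist : ContinuousOn (fun t => dist (f t) (f a) - K * (t - a)) (Icc a b) := by fun_prop
      rw [inter_comm]
      simpa only [preimage, mem_Iic, sub_nonpos] using
        hdist.preimage_isClosed_of_isClosed isClosed_Icc (isClosed_Iic (a := (0 : ℝ)))
    · rintro t ⟨ht, hat, htb⟩ y hy
      obtain ⟨i, hi⟩ : ∃ i, ∃ᶠ u in 𝓝[>] t, u ∈ S i := by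
        by_contra! hcon
        obtain ⟨u, hu, htu, hub⟩ :=
          ((Filter.eventually_all.2 hcon).and (Ioo_mem_nhdsGT htb)).exists
        obtain ⟨i, hui⟩ := mem_iUnion.1 (hcov ⟨hat.trans htu.le, hub.le⟩)
        exact hu i hui
      have htS : t ∈ S i := (hS i).closure_subset <|
        mem_closure_iff_frequently.2 (hi.filter_mono nhdsWithin_le_nhds)
      obtain ⟨u, huS, htu, huy⟩ := (hi.and_eventually (Ioo_mem_nhdsGT hy)).exists
      refine ⟨u, ?_, htu, huy.le⟩
      calc dist (f u) (f a) ≤ dist (f u) (f t) + dist (f t) (f a) := dist_triangle _ _ _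
        _ ≤ K * (u - t) + K * (t - a) := by
          refine add_le_add (((hf i).dist_le_mul u huS t htS).trans_eq ?_) ht
          rw [Real.dist_eq, abs_of_pos (sub_pos.2 htu)]
        _ = K * (u - a) := by ring
  exact hsub (right_mem_Icc.2 hab)

variable {E : Type*} [NormedAddCommGroup E] [NormedSpace ℝ E]

theorem lipschitzOnWith_of_finite_closed_cover {S : κ → Set E} {f : E → X} {B : Set E}
    (hB : Convex ℝ B) (hS : ∀ i, IsClosed (S i)) (hcov : B ⊆ ⋃ i, S i)
    (hf : ∀ i, LipschitzOnWith K f (S i)) : LipschitzOnWith K f B := by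
  refine LipschitzOnWith.of_dist_le_mul fun y hy x hx => ?_
  let c : ℝ → E := AffineMap.lineMap x y
  have hc : LipschitzWith (nndist x y) c := lipschitzWith_lineMap x y
  have hpath := dist_le_of_finite_closed_cover_Icc (f := f ∘ c) (K := K * nndist x y) zero_le_one
    (fun i => (hS i).preimage hc.continuous)
    (fun t ht => by simpa using hcov (hB.lineMap_mem hx hy ht))
    fun i => (hf i).comp hc.lipschitzOnWith (mapsTo_preimage c (S i))
  simpa [c, dist_comm y x] using hpath

end PiecewiseLipschitz

section WeakGradient

theorem norm_gradient {E : Type*} [NormedAddCommGroup E] [InnerProductSpace ℝ E] [CompleteSpace E]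
    (f : E → ℝ) (x : E) : ‖gradient f x‖ = ‖fderiv ℝ f x‖ := by
  rw [gradient, LinearIsometryEquiv.norm_map]

theorem measurable_gradient {E : Type*} [NormedAddCommGroup E] [InnerProductSpace ℝ E]
    [CompleteSpace E] [MeasurableSpace E] [BorelSpace E] (f : E → ℝ) : Measurable (gradient f) :=
  (LinearIsometryEquiv.continuous _).measurable.comp (measurable_fderiv ℝ f)

theorem integral_mul_fderiv_eq_of_lipschitzWith {E : Type*} [NormedAddCommGroup E]
    [NormedSpace ℝ E] [FiniteDimensional ℝ E] [MeasurableSpace E] [BorelSpace E] (μ : Measure E)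
    [μ.IsAddHaarMeasure] {L : NNReal} {f φ : E → ℝ} (hf : LipschitzWith L f) (hφ : ContDiff ℝ 1 φ)
    (hφc : HasCompactSupport φ) (e : E) :
    ∫ x, f x * fderiv ℝ φ x e ∂μ = -∫ x, fderiv ℝ f x e * φ x ∂μ := by
  obtain ⟨D, hD⟩ := hφ.lipschitzWith_of_hasCompactSupport hφc one_ne_zero
  have hline : ∫ x, fderiv ℝ f x e * φ x ∂μ = ∫ x, lineDeriv ℝ f x e * φ x ∂μ := by
    refine integral_congr_ae ?_
    filter_upwards [hf.ae_differentiableAt (μ := μ)] with x hx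
    rw [hx.lineDeriv_eq_fderiv]
  rw [hline, hf.integral_lineDeriv_mul_eq hD hφc e, ← integral_neg]
  refine integral_congr_ae (ae_of_all _ fun x => ?_)
  simp only [((hφ.differentiable one_ne_zero) x).lineDeriv_eq_fderiv, map_neg]
  ring

variable {d : ℕ} {U : Set (Eu d)} {f : Eu d → ℝ}

theorem hasWeakGradient_gradient (hf : LocallyLipschitzOn U f) :
    HasWeakGradient U f (gradient f) := by
  intro φ hφ hφc hφU e
  have hφ1 : ContDiff ℝ 1 φ := hφ.of_le (by simp)
  obtain ⟨L, hL⟩ := (hf.mono hφU).exists_lipschitzOnWith_of_compact hφc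
  obtain ⟨F, hF, hfF⟩ := hL.extend_real
  have hfun (x : Eu d) : f x * fderiv ℝ φ x e = F x * fderiv ℝ φ x e := by
    by_cases hx : x ∈ tsupport φ
    · rw [hfF hx]
    · simp only [fderiv_of_notMem_tsupport ℝ hx, zero_apply, mul_zero]
  have hgrad (x : Eu d) : inner ℝ (gradient f x) e * φ x = fderiv ℝ F x e * φ x := by
    by_cases hx : φ x = 0
    · simp only [hx, mul_zero]
    · have heq : f =ᶠ[𝓝 x] F := Filter.mem_of_superset
        (hφ.continuous.isOpen_support.mem_nhds hx) fun y hy => hfF (subset_tsupport φ hy)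
      rw [inner_gradient_left, heq.fderiv_eq]
  have hsupp {g : Eu d → ℝ} (hg : ∀ x ∉ tsupport φ, g x = 0) : ∫ x in U, g x = ∫ x, g x :=
    setIntegral_eq_integral_of_forall_compl_eq_zero fun x hx => hg x fun h => hx (hφU h)
  simp only [hfun, hgrad]
  rw [hsupp fun x hx => by simp only [fderiv_of_notMem_tsupport ℝ hx, zero_apply, mul_zero],
    hsupp fun x hx => by simp only [image_eq_zero_of_notMem_tsupport hx, mul_zero],
    integral_mul_fderiv_eq_of_lipschitzWith volume hF hφ1 hφc e]

end WeakGradient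

section PiecewisePolynomial

open scoped NNReal

variable {d m : ℕ} {S : Set (Eu d)} {f g : Eu d → ℝ}

theorem IsPolyOn.mono {n : ℕ} (hf : IsPolyOn n S f) (h : n ≤ m) : IsPolyOn m S f :=
  hf.imp fun _ hp => ⟨hp.1.trans h, hp.2⟩

theorem IsPolyOn.congr (hf : IsPolyOn m S f) (h : ∀ x ∈ S, g x = f x) : IsPolyOn m S g :=
  hf.imp fun _ hp => ⟨hp.1, fun x hx => (h x hx).trans (hp.2 x hx)⟩

theorem IsPolyOn.mul {n : ℕ} (hf : IsPolyOn m S f) (hg : IsPolyOn n S g) :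
    IsPolyOn (m + n) S fun x => f x * g x := by
  obtain ⟨p, hp, hfp⟩ := hf
  obtain ⟨q, hq, hgq⟩ := hg
  exact ⟨p * q, (MvPolynomial.totalDegree_mul p q).trans (add_le_add hp hq),
    fun x hx => by simp only [map_mul, hfp x hx, hgq x hx]⟩

theorem isPolyOn_affineMap (a : Eu d →ᵃ[ℝ] ℝ) (S : Set (Eu d)) : IsPolyOn 1 S a := by
  have ha (x : Eu d) : a x = ∑ j, a.linear (EuclideanSpace.single j 1) * x j + a 0 := by
    have hx : x = ∑ j, x j • EuclideanSpace.single j (1 : ℝ) := by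
      ext l
      simp [Finset.sum_apply, Pi.single_apply]
    conv_lhs => rw [a.decomp, Pi.add_apply, hx, map_sum]
    simp only [map_smul, smul_eq_mul, mul_comm]
  refine ⟨∑ j, MvPolynomial.C (a.linear (EuclideanSpace.single j 1)) * MvPolynomial.X j
    + MvPolynomial.C (a 0), ?_, fun x _ => by simp [ha x]⟩
  refine (MvPolynomial.totalDegree_add _ _).trans (max_le ?_ (by simp))
  refine MvPolynomial.totalDegree_finsetSum_le fun j _ =>
    (MvPolynomial.totalDegree_mul _ _).trans ?_
  simp

theorem totalDegree_aeval_le {σ τ R : Type*} [CommSemiring R] (p : MvPolynomial σ R)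
    {q : σ → MvPolynomial τ R} {n : ℕ} (hq : ∀ j, (q j).totalDegree ≤ n) :
    (MvPolynomial.aeval q p).totalDegree ≤ p.totalDegree * n := by
  rw [MvPolynomial.aeval_def, MvPolynomial.eval₂_eq]
  refine MvPolynomial.totalDegree_finsetSum_le fun s hs => ?_
  calc _ ≤ 0 + ∑ j ∈ s.support, s j * n := by
        refine (MvPolynomial.totalDegree_mul _ _).trans (add_le_add ?_ ?_)
        · exact (MvPolynomial.totalDegree_C _).le
        · refine (MvPolynomial.totalDegree_finsetProd _ _).trans (Finset.sum_le_sum fun j _ => ?_)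
          exact (MvPolynomial.totalDegree_pow _ _).trans (Nat.mul_le_mul_left _ (hq j))
    _ = s.degree * n := by rw [zero_add, ← Finset.sum_mul, Finsupp.degree_apply]
    _ ≤ p.totalDegree * n := Nat.mul_le_mul_right n (MvPolynomial.le_totalDegree hs)

theorem isPolyOn_eval_coords {ι : Type*} (b : AffineBasis ι ℝ (Eu d)) (p : MvPolynomial ι ℝ)
    (S : Set (Eu d)) : IsPolyOn p.totalDegree S fun x => MvPolynomial.eval (b.coords x) p := by
  choose q hq hbq using fun j => isPolyOn_affineMap (b.coord j) S
  refine ⟨MvPolynomial.aeval q p, (totalDegree_aeval_le p hq).trans_eq (mul_one _),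
    fun x hx => ?_⟩
  have hcoords : b.coords x = fun j => MvPolynomial.eval (fun l => x l) (q j) :=
    funext fun j => hbq j x hx
  change MvPolynomial.eval (b.coords x) p = _
  have halg : (MvPolynomial.eval fun l => x l).comp (algebraMap ℝ (MvPolynomial (Fin d) ℝ)) =
      RingHom.id ℝ := RingHom.ext fun c => MvPolynomial.eval_C c
  rw [hcoords, MvPolynomial.map_aeval, halg]
  rfl

theorem exists_lipschitzOnWith_eval {ι : Type*} [Fintype ι] {S : Set (ι → ℝ)} (hS : IsCompact S)
    (p : MvPolynomial ι ℝ) : ∃ K, LipschitzOnWith K (fun x => MvPolynomial.eval x p) S :=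
  (AnalyticOnNhd.eval_mvPolynomial p).contDiff.locallyLipschitz.locallyLipschitzOn
    |>.exists_lipschitzOnWith_of_compact hS

theorem IsPolyOn.exists_lipschitzOnWith (hf : IsPolyOn m S f) (hS : IsCompact S) :
    ∃ K, LipschitzOnWith K f S := by
  obtain ⟨p, -, hp⟩ := hf
  have hcoord := PiLp.lipschitzWith_ofLp 2 fun _ : Fin d => ℝ
  obtain ⟨K, hK⟩ := exists_lipschitzOnWith_eval (hS.image hcoord.continuous) p
  have hcomp := hK.comp hcoord.lipschitzOnWith (mapsTo_image _ S)
  exact ⟨_, fun x hx y hy => by rw [hp x hx, hp y hy]; exact hcomp hx hy⟩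

theorem isCompact_simplex (T : Finset (Eu d)) : IsCompact (simplex T) :=
  T.finite_toSet.isCompact_convexHull ℝ

variable {C : Finset (Finset (Eu d))} {U : Set (Eu d)} {K : ℝ≥0}

theorem exists_lipschitzOnWith_simplex (hf : ∀ T ∈ C, IsPolyOn m (simplex T) f) :
    ∃ K, ∀ T ∈ C, LipschitzOnWith K f (simplex T) :=
  exists_lipschitzOnWith_of_forall fun T hT =>
    (hf T hT).exists_lipschitzOnWith (isCompact_simplex T)

theorem continuousOn_biUnion_simplex (hf : ∀ T ∈ C, LipschitzOnWith K f (simplex T)) :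
    ContinuousOn f (⋃ T ∈ C, simplex T) := by
  rw [← iUnion_subtype (· ∈ C) fun T => simplex T.1]
  exact (locallyFinite_of_finite _).continuousOn_iUnion
    (fun T => (isCompact_simplex T.1).isClosed) fun T => (hf T.1 T.2).continuousOn

theorem lipschitzOnWith_of_subset_biUnion_simplex
    (hf : ∀ T ∈ C, LipschitzOnWith K f (simplex T)) {B : Set (Eu d)} (hB : Convex ℝ B)
    (hBC : B ⊆ ⋃ T ∈ C, simplex T) : LipschitzOnWith K f B := by
  rw [← iUnion_subtype (· ∈ C) fun T => simplex T.1] at hBC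
  exact lipschitzOnWith_of_finite_closed_cover (S := fun T : C => simplex T.1) hB
    (fun T => (isCompact_simplex T.1).isClosed) hBC fun T => hf T.1 T.2

theorem exists_ball_lipschitzOnWith (hU : IsOpen U) (hUC : U ⊆ ⋃ T ∈ C, simplex T)
    (hf : ∀ T ∈ C, LipschitzOnWith K f (simplex T)) {x : Eu d} (hx : x ∈ U) :
    ∃ r > 0, LipschitzOnWith K f (Metric.ball x r) := by
  obtain ⟨r, hr, hrU⟩ := Metric.isOpen_iff.1 hU x hx
  exact ⟨r, hr, lipschitzOnWith_of_subset_biUnion_simplex hf (convex_ball x r) (hrU.trans hUC)⟩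

theorem norm_gradient_le_of_lipschitzOnWith_simplex (hU : IsOpen U)
    (hUC : U ⊆ ⋃ T ∈ C, simplex T) (hf : ∀ T ∈ C, LipschitzOnWith K f (simplex T)) {x : Eu d}
    (hx : x ∈ U) : ‖gradient f x‖ ≤ K := by
  obtain ⟨r, hr, hlip⟩ := exists_ball_lipschitzOnWith hU hUC hf hx
  rw [norm_gradient]
  exact norm_fderiv_le_of_lipschitzOn ℝ (Metric.ball_mem_nhds x hr) hlip

theorem integrableOn_of_lipschitzOnWith_simplex (hUC : U ⊆ ⋃ T ∈ C, simplex T)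
    (hf : ∀ T ∈ C, LipschitzOnWith K f (simplex T)) : IntegrableOn f U :=
  ((continuousOn_biUnion_simplex hf).integrableOn_compact
    (C.isCompact_biUnion fun T _ => isCompact_simplex T)).mono_set hUC

theorem integrableOn_gradient_of_lipschitzOnWith_simplex (hU : IsOpen U)
    (hUC : U ⊆ ⋃ T ∈ C, simplex T) (hf : ∀ T ∈ C, LipschitzOnWith K f (simplex T)) :
    IntegrableOn (gradient f) U := by
  have hfin : volume U < ⊤ :=
    (measure_mono hUC).trans_lt (C.isCompact_biUnion fun T _ => isCompact_simplex T).measure_lt_top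
  refine Measure.integrableOn_of_bounded (M := K) hfin.ne
    (measurable_gradient f).aestronglyMeasurable ?_
  exact (ae_restrict_iff' hU.measurableSet).2 (ae_of_all _ fun x hx =>
    norm_gradient_le_of_lipschitzOnWith_simplex hU hUC hf hx)

theorem hasWeakGradient_of_lipschitzOnWith_simplex (hU : IsOpen U)
    (hUC : U ⊆ ⋃ T ∈ C, simplex T) (hf : ∀ T ∈ C, LipschitzOnWith K f (simplex T)) :
    HasWeakGradient U f (gradient f) := by
  refine hasWeakGradient_gradient fun x hx => ?_
  obtain ⟨r, hr, hlip⟩ := exists_ball_lipschitzOnWith hU hUC hf hx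
  exact ⟨K, Metric.ball x r, mem_nhdsWithin_of_mem_nhds (Metric.ball_mem_nhds x hr), hlip⟩

theorem hasWeakGradient_of_isPolyOn_simplex (hU : IsOpen U) (hUC : U ⊆ ⋃ T ∈ C, simplex T)
    (hf : ∀ T ∈ C, IsPolyOn m (simplex T) f) :
    IntegrableOn (gradient f) U ∧ HasWeakGradient U f (gradient f) := by
  obtain ⟨K, hK⟩ := exists_lipschitzOnWith_simplex hf
  exact ⟨integrableOn_gradient_of_lipschitzOnWith_simplex hU hUC hK,
    hasWeakGradient_of_lipschitzOnWith_simplex hU hUC hK⟩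

theorem mem_lagrangeSpace (hU : IsOpen U) (hUC : U ⊆ ⋃ T ∈ C, simplex T)
    (hf : ∀ T ∈ C, IsPolyOn m (simplex T) f) : f ∈ lagrangeSpace U C m := by
  obtain ⟨K, hK⟩ := exists_lipschitzOnWith_simplex hf
  exact ⟨⟨integrableOn_of_lipschitzOnWith_simplex hUC hK, gradient f,
    hasWeakGradient_of_isPolyOn_simplex hU hUC hf⟩, hf⟩

end PiecewisePolynomial

namespace Triangulation

section Geometry

variable {d : ℕ} {Ω : Set (Eu d)} (𝒯 : Triangulation Ω)

theorem mem_cellsAt {i : Eu d} {T : Finset (Eu d)} :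
    T ∈ 𝒯.cellsAt i ↔ T ∈ 𝒯.cells ∧ i ∈ simplex T := by
  simp [cellsAt]

theorem cellsAt_subset (i : Eu d) : 𝒯.cellsAt i ⊆ 𝒯.cells := fun _ h => (𝒯.mem_cellsAt.1 h).1

theorem closure_eq : closure Ω = ⋃ T ∈ 𝒯.cells, simplex T := by
  rw [← 𝒯.space_eq]
  ext x
  rw [Geometry.SimplicialComplex.mem_space_iff, mem_iUnion₂]
  constructor
  · rintro ⟨s, hs, hx⟩
    obtain ⟨t, ht, hst, hc⟩ := 𝒯.exists_cell s hs
    exact ⟨t, 𝒯.mem_cells.2 ⟨ht, hc⟩, convexHull_mono (Finset.coe_subset.2 hst) hx⟩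
  · rintro ⟨T, hT, hx⟩
    exact ⟨T, (𝒯.mem_cells.1 hT).1, hx⟩

theorem subset_biUnion_cells : Ω ⊆ ⋃ T ∈ 𝒯.cells, simplex T := by
  rw [← 𝒯.closure_eq]
  exact subset_closure

theorem isCompact_closure (𝒯 : Triangulation Ω) : IsCompact (closure Ω) := by
  rw [𝒯.closure_eq]
  exact 𝒯.cells.isCompact_biUnion fun T _ => isCompact_simplex T

theorem exists_basis {T : Finset (Eu d)} (hT : T ∈ 𝒯.cells) :
    ∃ b : AffineBasis (Fin (d + 1)) ℝ (Eu d), range b = (T : Set (Eu d)) ∧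
      ∀ j x, b.coord j x = bary T (b j) x := by
  let e : T ≃ Fin (d + 1) := T.equivFinOfCardEq (𝒯.mem_cells.1 hT).2
  let b₀ : AffineBasis T ℝ (Eu d) :=
    AffineBasis.mk ((↑) : T → Eu d) (𝒯.indep_of_cells hT) (𝒯.span_of_cells hT)
  refine ⟨b₀.reindex e, ?_, fun j x => ?_⟩
  · rw [AffineBasis.coe_reindex, e.symm.surjective.range_comp]
    exact Subtype.range_coe
  · have hj : (b₀.reindex e) j = (e.symm j : Eu d) := rfl
    rw [hj, bary, dif_pos ⟨𝒯.indep_of_cells hT, 𝒯.span_of_cells hT, (e.symm j).2⟩,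
      AffineBasis.coord_reindex]

open Classical in
/-- The vertices of a `d`-simplex of the triangulation, enumerated as an affine basis (and a
reference basis for other sets `T`). -/
def basis (T : Finset (Eu d)) : AffineBasis (Fin (d + 1)) ℝ (Eu d) :=
  if hT : T ∈ 𝒯.cells then (𝒯.exists_basis hT).choose else refBasis d

variable {𝒯} {T T' : Finset (Eu d)}

theorem range_basis (hT : T ∈ 𝒯.cells) : range (𝒯.basis T) = (T : Set (Eu d)) := by
  rw [basis, dif_pos hT]
  exact (𝒯.exists_basis hT).choose_spec.1

theorem coord_basis (hT : T ∈ 𝒯.cells) (j : Fin (d + 1)) (x : Eu d) :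
    (𝒯.basis T).coord j x = bary T (𝒯.basis T j) x := by
  rw [basis, dif_pos hT]
  exact (𝒯.exists_basis hT).choose_spec.2 j x

theorem hull_basis (hT : T ∈ 𝒯.cells) : convexHull ℝ (range (𝒯.basis T)) = simplex T := by
  rw [range_basis hT, simplex]

theorem basis_mem (hT : T ∈ 𝒯.cells) (j : Fin (d + 1)) : 𝒯.basis T j ∈ T := by
  rw [← Finset.mem_coe, ← range_basis hT]
  exact mem_range_self j

theorem exists_basis_eq (hT : T ∈ 𝒯.cells) {v : Eu d} (hv : v ∈ T) : ∃ j, 𝒯.basis T j = v := by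
  rwa [← Finset.mem_coe, ← range_basis hT] at hv

@[to_additive]
theorem prod_basis {M : Type*} [CommMonoid M] (hT : T ∈ 𝒯.cells) (f : Eu d → M) :
    ∏ j, f (𝒯.basis T j) = ∏ v ∈ T, f v :=
  Finset.prod_bij (fun j _ => 𝒯.basis T j) (fun j _ => basis_mem hT j)
    (fun _ _ _ _ h => (𝒯.basis T).ind.injective h)
    (fun _ hv => (exists_basis_eq hT hv).imp fun j hj => ⟨Finset.mem_univ j, hj⟩) fun _ _ => rfl

theorem mem_simplex_iff (hT : T ∈ 𝒯.cells) {x : Eu d} :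
    x ∈ simplex T ↔ ∀ j, 0 ≤ (𝒯.basis T).coords x j := by
  rw [← hull_basis hT, AffineBasis.convexHull_eq_nonneg_coord]
  rfl

theorem coords_mem (hT : T ∈ 𝒯.cells) {x : Eu d} (hx : x ∈ simplex T) :
    (𝒯.basis T).coords x ∈ stdSimplex ℝ (Fin (d + 1)) :=
  coords_mem_stdSimplex _ (by rwa [hull_basis hT])

theorem volume_simplex_pos (hT : T ∈ 𝒯.cells) : 0 < volume.real (simplex T) := by
  rw [← hull_basis hT]
  exact hull_volume_pos _

theorem interior_simplex (hT : T ∈ 𝒯.cells) :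
    interior (simplex T) = {x | ∀ j, 0 < (𝒯.basis T).coord j x} := by
  rw [← hull_basis hT, AffineBasis.interior_convexHull]

theorem interior_simplex_nonempty (hT : T ∈ 𝒯.cells) : (interior (simplex T)).Nonempty := by
  rw [← hull_basis hT]
  exact interior_convexHull_nonempty_iff_affineSpan_eq_top.2 (𝒯.basis T).tot

theorem simplex_subset_closure (hT : T ∈ 𝒯.cells) : simplex T ⊆ closure Ω := by
  rw [𝒯.closure_eq]
  exact subset_biUnion_of_mem (u := fun T => simplex T) hT

theorem exists_notMem_of_ne (hT : T ∈ 𝒯.cells) (hT' : T' ∈ 𝒯.cells) (h : T ≠ T') :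
    ∃ v ∈ T, v ∉ T' := by
  by_contra! hsub
  exact h (Finset.eq_of_subset_of_card_le hsub
    (by rw [(𝒯.mem_cells.1 hT).2, (𝒯.mem_cells.1 hT').2]))

theorem disjoint_interior (hT : T ∈ 𝒯.cells) (hT' : T' ∈ 𝒯.cells) (h : T ≠ T') :
    Disjoint (interior (simplex T)) (simplex T') := by
  rw [Set.disjoint_left]
  intro x hx hx'
  obtain ⟨v, hv, hv'⟩ := exists_notMem_of_ne hT hT' h
  obtain ⟨j, rfl⟩ := exists_basis_eq hT hv
  have h0 := 𝒯.bary_eq_of_mem hT hT' (interior_subset hx) hx' (𝒯.basis T j)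
  rw [bary_of_notMem hv', ← coord_basis hT] at h0
  rw [interior_simplex hT] at hx
  exact (hx j).ne' h0

theorem frontier_simplex_null (T : Finset (Eu d)) : volume (frontier (simplex T)) = 0 :=
  (convex_convexHull ℝ _).addHaar_frontier volume

theorem aedisjoint_simplex (hT : T ∈ 𝒯.cells) (hT' : T' ∈ 𝒯.cells) (h : T ≠ T') :
    AEDisjoint volume (simplex T) (simplex T') := by
  refine measure_mono_null (t := frontier (simplex T)) ?_ (frontier_simplex_null T)
  rintro x ⟨hx, hx'⟩
  rw [(isCompact_simplex T).isClosed.frontier_eq]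
  exact ⟨hx, fun hi => Set.disjoint_left.1 (disjoint_interior hT hT' h) hi hx'⟩

theorem setIntegral_biUnion_simplex {C : Finset (Finset (Eu d))} (hC : C ⊆ 𝒯.cells)
    {f : Eu d → ℝ} (hf : IntegrableOn f (⋃ T ∈ C, simplex T)) :
    ∫ x in ⋃ T ∈ C, simplex T, f x = ∑ T ∈ C, ∫ x in simplex T, f x := by
  have hunion : ⋃ T ∈ C, simplex T = ⋃ T : C, simplex T.1 := by rw [iUnion_subtype]
  have hdisj : Pairwise (Function.onFun (AEDisjoint volume) fun T : C => simplex T.1) :=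
    fun T T' h => aedisjoint_simplex (hC T.2) (hC T'.2) fun h' => h (Subtype.ext h')
  have hmeas (T : C) : NullMeasurableSet (simplex T.1) volume :=
    (isCompact_simplex T.1).measurableSet.nullMeasurableSet
  have hsum := integral_iUnion_ae hmeas hdisj (hunion ▸ hf)
  rw [tsum_fintype] at hsum
  rw [hunion, hsum]
  exact Finset.sum_coe_sort C fun T => ∫ x in simplex T, f x

theorem isCompact_patch (i : Eu d) : IsCompact (𝒯.patch i) :=
  (𝒯.cellsAt i).isCompact_biUnion fun T _ => isCompact_simplex T

theorem volume_patch (i : Eu d) :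
    volume.real (𝒯.patch i) = ∑ T ∈ 𝒯.cellsAt i, volume.real (simplex T) := by
  have h := setIntegral_biUnion_simplex (𝒯.cellsAt_subset i) (f := fun _ => 1)
    (integrableOn_const (isCompact_patch i).measure_ne_top)
  simpa [patch] using h

theorem volume_patch_pos {i : Eu d} (hT : T ∈ 𝒯.cellsAt i) : 0 < volume.real (𝒯.patch i) := by
  rw [volume_patch]
  exact Finset.sum_pos (fun T hT => volume_simplex_pos (𝒯.cellsAt_subset i hT)) ⟨T, hT⟩

theorem interior_simplex_subset (hΩ : interior (closure Ω) = Ω) (hT : T ∈ 𝒯.cells) :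
    interior (simplex T) ⊆ Ω :=
  (interior_mono (simplex_subset_closure hT)).trans hΩ.subset

theorem ae_eq_closure (hΩ : interior (closure Ω) = Ω) (𝒯 : Triangulation Ω) :
    Ω =ᵐ[volume] closure Ω := by
  refine subset_closure.eventuallyLE.antisymm ?_
  rw [ae_le_set]
  refine measure_mono_null (t := ⋃ T ∈ 𝒯.cells, frontier (simplex T)) ?_
    ((measure_biUnion_null_iff 𝒯.cells.countable_toSet).2 fun T _ => frontier_simplex_null T)
  rintro x ⟨hx, hxΩ⟩
  rw [𝒯.closure_eq] at hx
  obtain ⟨T, hT, hxT⟩ := mem_iUnion₂.1 hx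
  refine mem_iUnion₂.2 ⟨T, hT, ?_⟩
  rw [(isCompact_simplex T).isClosed.frontier_eq]
  exact ⟨hxT, fun h => hxΩ (interior_simplex_subset hΩ hT h)⟩

theorem setIntegral_eq_sum (hΩ : interior (closure Ω) = Ω) (𝒯 : Triangulation Ω) {f : Eu d → ℝ}
    (hf : ContinuousOn f (closure Ω)) :
    ∫ x in Ω, f x = ∑ T ∈ 𝒯.cells, ∫ x in simplex T, f x := by
  have hint := hf.integrableOn_compact (μ := volume) 𝒯.isCompact_closure
  rw [setIntegral_congr_set (ae_eq_closure hΩ 𝒯)]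
  rw [𝒯.closure_eq] at hint ⊢
  exact setIntegral_biUnion_simplex Subset.rfl hint

theorem exists_perm_basis_eq (hT : T ∈ 𝒯.cells) (hT' : T' ∈ 𝒯.cells) :
    ∃ σ : Equiv.Perm (Fin (d + 1)), ∀ j, 𝒯.basis T' (σ j) = 𝒯.basis T j ∨
      𝒯.basis T j ∉ T' ∧ 𝒯.basis T' (σ j) ∉ T := by
  classical
  choose f hf using fun j : {j // 𝒯.basis T j ∈ T'} => exists_basis_eq hT' j.2
  let g (j : {j // 𝒯.basis T j ∈ T'}) : {l // 𝒯.basis T' l ∈ T} :=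
    ⟨f j, hf j ▸ basis_mem hT j.1⟩
  have hg : Function.Bijective g := by
    refine ⟨fun j l h => Subtype.ext ((𝒯.basis T).ind.injective ?_), fun ⟨l, hl⟩ => ?_⟩
    · rw [← hf j, ← hf l, show f j = f l from congrArg Subtype.val h]
    · obtain ⟨j, hj⟩ := exists_basis_eq hT hl
      refine ⟨⟨j, hj ▸ basis_mem hT' l⟩, Subtype.ext ((𝒯.basis T').ind.injective ?_)⟩
      exact (hf _).trans hj
  let e := Equiv.ofBijective g hg
  refine ⟨e.extendSubtype, fun j => ?_⟩
  by_cases hj : 𝒯.basis T j ∈ T'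
  · rw [Equiv.extendSubtype_apply_of_mem e j hj]
    exact .inl (hf ⟨j, hj⟩)
  · exact .inr ⟨hj, e.extendSubtype_not_mem j hj⟩

theorem exists_perm_coords (hT : T ∈ 𝒯.cells) (hT' : T' ∈ 𝒯.cells) :
    ∃ σ : Equiv.Perm (Fin (d + 1)), ∀ x ∈ simplex T, x ∈ simplex T' →
      (𝒯.basis T).coords x = (𝒯.basis T').coords x ∘ σ := by
  obtain ⟨σ, hσ⟩ := exists_perm_basis_eq hT hT'
  refine ⟨σ, fun x hx hx' => ?_⟩
  ext j
  simp only [Function.comp_apply, AffineBasis.coords_apply, coord_basis hT, coord_basis hT']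
  rcases hσ j with hj | ⟨hj, hj'⟩
  · rw [hj, 𝒯.bary_eq_of_mem hT hT' hx hx']
  · rw [𝒯.bary_eq_of_mem hT hT' hx hx', bary_of_notMem hj, ← 𝒯.bary_eq_of_mem hT hT' hx hx',
      bary_of_notMem hj']

end Geometry

section Nodes

variable {d : ℕ} {Ω : Set (Eu d)} {𝒯 : Triangulation Ω} {T T' : Finset (Eu d)} {k : ℕ} {i : Eu d}

theorem sum_natCast_div_eq_one {ι : Type*} {s : Finset ι} {α : ι → ℕ} (hk : 1 ≤ k)
    (hα : ∑ v ∈ s, α v = k) : ∑ v ∈ s, (α v : ℝ) / k = 1 := by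
  rw [← Finset.sum_div, ← Nat.cast_sum, hα, div_self (by positivity)]

theorem sum_div_smul_mem_simplex {α : Eu d → ℕ} (hk : 1 ≤ k) (hα : ∑ v ∈ T, α v = k) :
    ∑ v ∈ T, ((α v : ℝ) / k) • v ∈ simplex T :=
  (convex_convexHull ℝ _).sum_mem (fun v _ => by positivity) (sum_natCast_div_eq_one hk hα)
    fun v hv => subset_convexHull ℝ _ hv

theorem exists_cellsAt_of_node (hk : 1 ≤ k) (hi : i ∈ 𝒯.nodes k) :
    ∃ T ∈ 𝒯.cellsAt i, ∃ α : Eu d → ℕ, ∑ v ∈ T, α v = k ∧ i = ∑ v ∈ T, ((α v : ℝ) / k) • v := by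
  classical
  simp only [nodes, Finset.mem_biUnion, Finset.mem_image, Finset.mem_piAntidiag] at hi
  obtain ⟨T, hT, α, ⟨hα, -⟩, rfl⟩ := hi
  exact ⟨T, 𝒯.mem_cellsAt.2 ⟨hT, sum_div_smul_mem_simplex hk hα⟩, α, hα, rfl⟩

theorem cast_multiIndex (hk : 1 ≤ k) (hi : i ∈ 𝒯.nodes k) (hT : T ∈ 𝒯.cellsAt i) (v : Eu d) :
    (multiIndex k T i v : ℝ) = k * bary T v i := by
  obtain ⟨T₀, hT₀, α, hα, hiα⟩ := exists_cellsAt_of_node hk hi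
  obtain ⟨hT₀, hiT₀⟩ := 𝒯.mem_cellsAt.1 hT₀
  obtain ⟨hT, hiT⟩ := 𝒯.mem_cellsAt.1 hT
  rw [multiIndex, 𝒯.bary_eq_of_mem hT hT₀ hiT hiT₀ v]
  by_cases hv : v ∈ T₀
  · have hbary : bary T₀ v i = (α v : ℝ) / k :=
      hiα ▸ 𝒯.bary_sum hT₀ (fun v => (α v : ℝ) / k) (sum_natCast_div_eq_one hk hα) hv
    rw [hbary, mul_div_cancel₀ _ (by positivity), Nat.floor_natCast]
  · simp [bary_of_notMem hv]

/-- The multi-index of a node with respect to the enumeration of the vertices. -/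
def nodeIndex (𝒯 : Triangulation Ω) (k : ℕ) (T : Finset (Eu d)) (i : Eu d) : Fin (d + 1) → ℕ :=
  fun j => multiIndex k T i (𝒯.basis T j)

theorem cast_nodeIndex (hk : 1 ≤ k) (hi : i ∈ 𝒯.nodes k) (hT : T ∈ 𝒯.cellsAt i)
    (j : Fin (d + 1)) : (𝒯.nodeIndex k T i j : ℝ) = k * (𝒯.basis T).coords i j := by
  rw [nodeIndex, cast_multiIndex hk hi hT, ← coord_basis (𝒯.cellsAt_subset i hT),
    AffineBasis.coords_apply]

theorem nodeIndex_mem (hk : 1 ≤ k) (hi : i ∈ 𝒯.nodes k) (hT : T ∈ 𝒯.cellsAt i) :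
    𝒯.nodeIndex k T i ∈ Finset.univ.piAntidiag k := by
  rw [Finset.mem_piAntidiag]
  refine ⟨?_, fun j _ => Finset.mem_univ j⟩
  have hsum : ((∑ j, 𝒯.nodeIndex k T i j : ℕ) : ℝ) = k := by
    simp only [Nat.cast_sum, cast_nodeIndex hk hi hT, ← Finset.mul_sum, AffineBasis.coords_apply,
      AffineBasis.sum_coord_apply_eq_one, mul_one]
  exact_mod_cast hsum

theorem injOn_nodeIndex (hk : 1 ≤ k) (T : Finset (Eu d)) :
    InjOn (𝒯.nodeIndex k T) {i | i ∈ 𝒯.nodes k ∧ T ∈ 𝒯.cellsAt i} := by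
  rintro i ⟨hi, hT⟩ i' ⟨hi', hT'⟩ h
  refine AffineBasis.ext_elem (𝒯.basis T) fun j => ?_
  have hk' : (k : ℝ) ≠ 0 := by positivity
  refine mul_left_cancel₀ hk' ?_
  rw [← AffineBasis.coords_apply, ← AffineBasis.coords_apply, ← cast_nodeIndex hk hi hT,
    ← cast_nodeIndex hk hi' hT', h]

theorem exists_nodeIndex_eq (hk : 1 ≤ k) (hT : T ∈ 𝒯.cells) {α : Fin (d + 1) → ℕ}
    (hα : α ∈ Finset.univ.piAntidiag k) :
    ∃ i ∈ 𝒯.nodes k, T ∈ 𝒯.cellsAt i ∧ 𝒯.nodeIndex k T i = α := by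
  classical
  let a : Eu d → ℕ := Function.extend (𝒯.basis T) α 0
  have ha (j) : a (𝒯.basis T j) = α j := (𝒯.basis T).ind.injective.extend_apply _ _ _
  have hsum : ∑ v ∈ T, a v = k := by
    rw [← sum_basis hT]
    simp only [ha]
    exact (Finset.mem_piAntidiag.1 hα).1
  have hsupp (v : Eu d) (hv : a v ≠ 0) : v ∈ T := by
    by_contra hvT
    exact hv (Function.extend_apply' _ _ _ fun ⟨j, hj⟩ => hvT (hj ▸ basis_mem hT j))
  refine ⟨∑ v ∈ T, ((a v : ℝ) / k) • v, ?_,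
    𝒯.mem_cellsAt.2 ⟨hT, sum_div_smul_mem_simplex hk hsum⟩, ?_⟩
  · simp only [nodes, Finset.mem_biUnion, Finset.mem_image]
    exact ⟨T, hT, a, Finset.mem_piAntidiag.2 ⟨hsum, hsupp⟩, rfl⟩
  · ext j
    rw [nodeIndex, 𝒯.multiIndex_node hk hT a hsum (basis_mem hT j), ha]

theorem exists_perm_nodeIndex (hT : T ∈ 𝒯.cells) (hT' : T' ∈ 𝒯.cells) :
    ∃ σ : Equiv.Perm (Fin (d + 1)),
      (∀ x ∈ simplex T ∩ simplex T', (𝒯.basis T).coords x = (𝒯.basis T').coords x ∘ σ) ∧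
      ∀ i ∈ simplex T ∩ simplex T', 𝒯.nodeIndex k T i = 𝒯.nodeIndex k T' i ∘ σ := by
  obtain ⟨σ, hσ⟩ := exists_perm_coords hT hT'
  refine ⟨σ, fun x hx => hσ x hx.1 hx.2, fun i hi => ?_⟩
  ext j
  have hj := congrFun (hσ i hi.1 hi.2) j
  rw [Function.comp_apply, AffineBasis.coords_apply, AffineBasis.coords_apply, coord_basis hT,
    coord_basis hT'] at hj
  rw [Function.comp_apply, nodeIndex, nodeIndex, multiIndex, multiIndex, hj]

theorem bernstein_eq_eval (hT : T ∈ 𝒯.cellsAt i) {x : Eu d} (hx : x ∈ simplex T) :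
    𝒯.bernstein k i x =
      MvPolynomial.eval ((𝒯.basis T).coords x) (bernPoly (𝒯.nodeIndex k T i)) := by
  have hT' := 𝒯.cellsAt_subset i hT
  rw [𝒯.bernstein_eq k hT hx, eval_bernPoly, bernsteinLocal]
  simp only [nodeIndex, AffineBasis.coords_apply, coord_basis hT']
  rw [sum_basis hT' (multiIndex k T i),
    prod_basis hT' fun v => (Nat.factorial (multiIndex k T i v) : ℝ),
    prod_basis hT' fun v => bary T v x ^ multiIndex k T i v]

theorem mem_simplex_of_bary_eq_zero (hT : T ∈ 𝒯.cells) {x : Eu d} (hx : x ∈ simplex T)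
    (h : ∀ v ∈ T, v ∉ T' → bary T v x = 0) : x ∈ simplex T' := by
  have hnotMem : ∀ v ∈ T', v ∉ T → bary T v x = 0 := fun v _ hv => bary_of_notMem hv x
  rw [simplex, Finset.mem_convexHull']
  refine ⟨fun v => bary T v x, fun v _ => ?_, ?_, ?_⟩
  · by_cases hv : v ∈ T
    · obtain ⟨j, rfl⟩ := exists_basis_eq hT hv
      exact (coord_basis hT j x).subst ((mem_simplex_iff hT).1 hx j)
    · exact (bary_of_notMem hv x).ge
  · rw [← (𝒯.basis T).sum_coord_apply_eq_one x]
    simp only [coord_basis hT]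
    rw [sum_basis hT fun v => bary T v x]
    exact Finset.sum_congr_of_eq_on_inter hnotMem h fun _ _ _ => rfl
  · conv_rhs => rw [← (𝒯.basis T).linear_combination_coord_eq_self x]
    simp only [coord_basis hT]
    rw [sum_basis hT fun v => bary T v x • v]
    exact Finset.sum_congr_of_eq_on_inter (fun v hv hvT => by rw [hnotMem v hv hvT, zero_smul])
      (fun v hv hvT => by rw [h v hv hvT, zero_smul]) fun _ _ _ => rfl

theorem bernstein_eq_zero (hk : 1 ≤ k) (hi : i ∈ 𝒯.nodes k) (hT : T ∈ 𝒯.cells)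
    (hiT : i ∉ simplex T) {x : Eu d} (hx : x ∈ simplex T) : 𝒯.bernstein k i x = 0 := by
  by_cases h : ∃ S ∈ 𝒯.cellsAt i, x ∈ simplex S
  swap
  · rw [bernstein, dif_neg h]
  obtain ⟨S, hS, hxS⟩ := h
  obtain ⟨hSc, hiS⟩ := 𝒯.mem_cellsAt.1 hS
  obtain ⟨v, hvS, hvT, hv⟩ : ∃ v ∈ S, v ∉ T ∧ bary S v i ≠ 0 := by
    by_contra! hcon
    exact hiT (mem_simplex_of_bary_eq_zero hSc hiS hcon)
  have hexp : multiIndex k S i v ≠ 0 := by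
    rw [← Nat.cast_ne_zero (R := ℝ), cast_multiIndex hk hi hS]
    exact mul_ne_zero (by positivity) hv
  rw [𝒯.bernstein_eq k hS hxS, bernsteinLocal,
    Finset.prod_eq_zero (f := fun v => bary S v x ^ multiIndex k S i v) hvS, mul_zero]
  simp only [𝒯.bary_eq_of_mem hSc hT hxS hx, bary_of_notMem hvT, zero_pow hexp]

end Nodes

end Triangulation

section ConvexBodies

variable {E : Type*} [NormedAddCommGroup E] [NormedSpace ℝ E] {c x y : E} {r : ℝ}

theorem abs_sub_le_of_mapsTo_closedBall (a : E →ᵃ[ℝ] ℝ) (hr : 0 < r)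
    (ha : MapsTo a (Metric.closedBall c r) (Icc 0 1)) (x y : E) :
    |a x - a y| ≤ (2 * r)⁻¹ * dist x y := by
  rcases eq_or_ne x y with rfl | hxy
  · simp
  have hn : 0 < ‖x - y‖ := norm_pos_iff.2 (sub_ne_zero.2 hxy)
  set u : E := (r / ‖x - y‖) • (x - y) with hu
  have hun : ‖u‖ = r := by
    rw [hu, norm_smul, Real.norm_of_nonneg (by positivity), div_mul_cancel₀ _ hn.ne']
  have hdiff : a (c + u) - a (c - u) = 2 * r / ‖x - y‖ * (a x - a y) := by
    rw [← vsub_eq_sub (a (c + u)), ← vsub_eq_sub (a x), ← a.linearMap_vsub, ← a.linearMap_vsub,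
      ← smul_eq_mul, ← map_smul, vsub_eq_sub, vsub_eq_sub, mul_div_assoc, mul_smul, ← hu, two_smul]
    congr 1
    abel
  have hdiam : |a (c + u) - a (c - u)| ≤ 1 := by
    obtain ⟨hadd, hadd'⟩ := ha (show c + u ∈ _ by simp [hun])
    obtain ⟨hsub, hsub'⟩ := ha (show c - u ∈ _ by simp [hun])
    rw [abs_le]
    constructor <;> linarith
  rw [hdiff, abs_mul, abs_of_pos (by positivity), ← le_div_iff₀' (by positivity),
    one_div_div] at hdiam
  rwa [dist_eq_norm, inv_mul_eq_div]

theorem dist_homothety_homothety (x y z : E) (t : ℝ) :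
    dist (AffineMap.homothety x t y) (AffineMap.homothety x t z) = |t| * dist y z := by
  rw [dist_eq_norm_vsub E, ← AffineMap.linearMap_vsub, AffineMap.homothety_linear,
    LinearMap.smul_apply, LinearMap.id_apply, norm_smul, Real.norm_eq_abs, ← dist_eq_norm_vsub]

theorem closedBall_homothety_subset {S : Set E} (hS : Convex ℝ S) (hx : x ∈ S) {D : ℝ}
    (hSD : S ⊆ Metric.closedBall x D) (hc : Metric.closedBall c r ⊆ S) {t : ℝ}
    (ht : t ∈ Ioc (0 : ℝ) 1) :
    Metric.closedBall (AffineMap.homothety x t c) (t * r) ⊆ S ∩ Metric.closedBall x (t * D) := by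
  intro y hy
  obtain ⟨z, rfl⟩ : ∃ z, AffineMap.homothety x t z = y :=
    ⟨AffineMap.homothety x t⁻¹ y, by
      rw [← AffineMap.homothety_mul_apply, mul_inv_cancel₀ ht.1.ne', AffineMap.homothety_one,
        AffineMap.id_apply]⟩
  rw [Metric.mem_closedBall, dist_homothety_homothety, abs_of_pos ht.1,
    mul_le_mul_iff_right₀ ht.1] at hy
  have hz : z ∈ S := hc hy
  refine ⟨?_, ?_⟩
  · rw [AffineMap.homothety_eq_lineMap]
    exact hS.lineMap_mem hx hz ⟨ht.1.le, ht.2⟩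
  · rw [Metric.mem_closedBall, dist_homothety_center, Real.norm_of_nonneg ht.1.le, dist_comm]
    exact mul_le_mul_of_nonneg_left (hSD hz) ht.1.le

theorem card_mul_pow_le_of_closedBall_packing [FiniteDimensional ℝ E] [MeasurableSpace E]
    [BorelSpace E] (μ : Measure E) [μ.IsAddHaarMeasure] {κ : Type*} (s : Finset κ) {c : κ → E}
    {R : ℝ} (hr : 0 ≤ r) (hR : 0 ≤ R)
    (hsub : ∀ j ∈ s, Metric.closedBall (c j) r ⊆ Metric.closedBall x R)
    (hdisj : (s : Set κ).Pairwise fun j l =>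
      AEDisjoint μ (Metric.closedBall (c j) r) (Metric.closedBall (c l) r)) :
    s.card * r ^ Module.finrank ℝ E ≤ R ^ Module.finrank ℝ E := by
  have hvol : ∑ j ∈ s, μ (Metric.closedBall (c j) r) ≤ μ (Metric.closedBall x R) := by
    rw [← measure_biUnion_finset₀ hdisj
      fun j _ => Metric.isClosed_closedBall.measurableSet.nullMeasurableSet]
    exact measure_mono (iUnion₂_subset hsub)
  simp only [Measure.addHaar_closedBall _ _ hr, Measure.addHaar_closedBall _ _ hR,
    Finset.sum_const, nsmul_eq_mul, ← mul_assoc] at hvol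
  have hreal := (ENNReal.mul_le_mul_iff_left (Metric.measure_ball_pos μ 0 one_pos).ne'
    measure_ball_lt_top.ne).1 hvol
  rw [← ENNReal.ofReal_natCast, ← ENNReal.ofReal_mul (by positivity)] at hreal
  exact (ENNReal.ofReal_le_ofReal_iff (by positivity)).1 hreal

theorem eventually_nonempty_sphere_inter {S : Set E} (hS : Convex ℝ S) (hx : x ∈ S)
    (hne : ∃ y ∈ S, y ≠ x) : ∀ᶠ ρ : ℝ in 𝓝[>] 0, (Metric.sphere x ρ ∩ S).Nonempty := by
  obtain ⟨y, hy, hyx⟩ := hne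
  have hdist : 0 < dist x y := dist_pos.2 hyx.symm
  filter_upwards [Ioo_mem_nhdsGT hdist] with ρ hρ
  have h0 : 0 ≤ ρ / dist x y := div_nonneg hρ.1.le hdist.le
  refine ⟨AffineMap.lineMap x y (ρ / dist x y), ?_,
    hS.lineMap_mem hx hy ⟨h0, (div_le_one hdist).2 hρ.2.le⟩⟩
  rw [Metric.mem_sphere, dist_lineMap_left, Real.norm_of_nonneg h0, div_mul_cancel₀ _ hdist.ne']

end ConvexBodies

theorem preconnected_of_finite_closed_cover {X ι : Type*} [TopologicalSpace X] [Finite ι]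
    {G : SimpleGraph ι} {S : ι → Set X} (hS : ∀ i, IsClosed (S i)) {W : Set X}
    (hW : IsPreconnected W) (hWS : W ⊆ ⋃ i, S i) (hne : ∀ i, (W ∩ S i).Nonempty)
    (hG : ∀ i j, i ≠ j → (W ∩ (S i ∩ S j)).Nonempty → G.Adj i j) : G.Preconnected := by
  intro i j
  by_contra hij
  have hclosed (p : ι → Prop) : IsClosed (⋃ l ∈ {l | p l}, S l) :=
    (Set.toFinite _).isClosed_biUnion fun l _ => hS l
  obtain ⟨y, hyW, hy, hy'⟩ := isPreconnected_closed_iff.1 hW _ _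
    (hclosed (G.Reachable i)) (hclosed fun l => ¬ G.Reachable i l)
    (fun y hy => by
      obtain ⟨l, hl⟩ := mem_iUnion.1 (hWS hy)
      exact (em (G.Reachable i l)).imp (mem_biUnion (x := l) · hl) (mem_biUnion (x := l) · hl))
    ((hne i).mono (inter_subset_inter_right W (subset_biUnion_of_mem (u := S) (.refl i))))
    ((hne j).mono (inter_subset_inter_right W (subset_biUnion_of_mem (u := S) hij)))
  obtain ⟨l, hl, hyl⟩ := mem_iUnion₂.1 hy
  obtain ⟨m, hm, hym⟩ := mem_iUnion₂.1 hy'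
  have hadj := hG l m (fun h => hm (h ▸ hl)) ⟨y, hyW, hyl, hym⟩
  exact hm (SimpleGraph.Reachable.trans hl hadj.reachable)

/-- The domain `Ω` has no pinch points: every frontier point has arbitrarily small open
neighbourhoods whose trace on `Ω` is connected. -/
def LocallyConnectedAtFrontier {d : ℕ} (Ω : Set (Eu d)) : Prop :=
  ∀ x ∈ frontier Ω, ∀ U ∈ 𝓝 x, ∃ V ⊆ U, IsOpen V ∧ x ∈ V ∧ IsConnected (V ∩ Ω)

namespace Triangulation

section ShapeRegularity

variable {d : ℕ} {Ω : Set (Eu d)} {𝒯 : Triangulation Ω} {T T' : Finset (Eu d)}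

theorem abs_coord_sub_le (hT : T ∈ 𝒯.cells) {c : Eu d} {r : ℝ} (hr : 0 < r)
    (hball : Metric.closedBall c r ⊆ simplex T) (j : Fin (d + 1)) (x y : Eu d) :
    |(𝒯.basis T).coord j x - (𝒯.basis T).coord j y| ≤ (2 * r)⁻¹ * dist x y :=
  abs_sub_le_of_mapsTo_closedBall _ hr
    (fun _ hz => mem_Icc_of_mem_stdSimplex (coords_mem hT (hball hz)) j) x y

theorem lipschitzWith_coords (hT : T ∈ 𝒯.cells) {c : Eu d} {r : ℝ} (hr : 0 < r)
    (hball : Metric.closedBall c r ⊆ simplex T) :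
    LipschitzWith (Real.toNNReal (2 * r)⁻¹) (𝒯.basis T).coords := by
  refine LipschitzWith.of_dist_le_mul fun x y => ?_
  rw [dist_pi_le_iff (by positivity), Real.coe_toNNReal _ (by positivity)]
  exact fun j => abs_coord_sub_le hT hr hball j x y

theorem dist_le_diam_simplex {x y : Eu d} (hx : x ∈ simplex T) (hy : y ∈ simplex T) :
    dist x y ≤ Metric.diam (simplex T) :=
  Metric.dist_le_diam_of_mem (isCompact_simplex T).isBounded hx hy

theorem vertex_mem_simplex {v : Eu d} (hv : v ∈ T) : v ∈ simplex T := subset_convexHull ℝ _ hv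

theorem exists_ne_vertices (hd : 1 ≤ d) (hT : T ∈ 𝒯.cells) : ∃ v ∈ T, ∃ w ∈ T, v ≠ w :=
  Finset.one_lt_card.1 (by rw [(𝒯.mem_cells.1 hT).2]; lia)

theorem two_mul_radius_le_dist (hT : T ∈ 𝒯.cells) {c : Eu d} {r : ℝ} (hr : 0 < r)
    (hball : Metric.closedBall c r ⊆ simplex T) {v w : Eu d} (hv : v ∈ T) (hw : w ∈ T)
    (hvw : v ≠ w) : 2 * r ≤ dist v w := by
  obtain ⟨j, rfl⟩ := exists_basis_eq hT hv
  obtain ⟨l, rfl⟩ := exists_basis_eq hT hw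
  have h := abs_coord_sub_le hT hr hball j (𝒯.basis T j) (𝒯.basis T l)
  rwa [AffineBasis.coord_apply_eq, AffineBasis.coord_apply_ne _ (fun h => hvw (congrArg _ h)),
    sub_zero, abs_one, inv_mul_eq_div, le_div_iff₀ (by positivity), one_mul] at h

theorem two_mul_radius_le_diam (hd : 1 ≤ d) (hT : T ∈ 𝒯.cells) {c : Eu d} {r : ℝ} (hr : 0 < r)
    (hball : Metric.closedBall c r ⊆ simplex T) : 2 * r ≤ Metric.diam (simplex T) := by
  obtain ⟨v, hv, w, hw, hvw⟩ := exists_ne_vertices hd hT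
  exact (two_mul_radius_le_dist hT hr hball hv hw hvw).trans
    (dist_le_diam_simplex (vertex_mem_simplex hv) (vertex_mem_simplex hw))

variable {γ : ℝ}

theorem ShapeRegular.two_le (hγ : 𝒯.ShapeRegular γ) (hd : 1 ≤ d) (hT : T ∈ 𝒯.cells) : 2 ≤ γ := by
  obtain ⟨c, r, hr, hball, hdiam⟩ := hγ.1 T hT
  exact le_of_mul_le_mul_right ((two_mul_radius_le_diam hd hT hr hball).trans hdiam) hr

theorem ShapeRegular.diam_pos (hγ : 𝒯.ShapeRegular γ) (hd : 1 ≤ d) (hT : T ∈ 𝒯.cells) :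
    0 < Metric.diam (simplex T) := by
  obtain ⟨c, r, hr, hball, -⟩ := hγ.1 T hT
  linarith [two_mul_radius_le_diam hd hT hr hball]

theorem ShapeRegular.diam_le_of_common_edge (hγ : 𝒯.ShapeRegular γ) (hd : 1 ≤ d)
    (hT : T ∈ 𝒯.cells) (hedge : ((T : Set (Eu d)) ∩ T').Nontrivial) :
    Metric.diam (simplex T) ≤ γ * Metric.diam (simplex T') := by
  obtain ⟨v, ⟨hv, hv'⟩, w, ⟨hw, hw'⟩, hvw⟩ := hedge
  obtain ⟨c, r, hr, hball, hdiam⟩ := hγ.1 T hT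
  have hγ2 := hγ.two_le hd hT
  refine hdiam.trans (mul_le_mul_of_nonneg_left ?_ (by linarith))
  have hlower := two_mul_radius_le_dist hT hr hball hv hw hvw
  have hupper := dist_le_diam_simplex (vertex_mem_simplex hv') (vertex_mem_simplex hw')
  linarith

theorem ShapeRegular.exists_closedBall_subset (hγ : 𝒯.ShapeRegular γ) (hd : 1 ≤ d) {x : Eu d}
    (hT : T ∈ 𝒯.cellsAt x) {s : ℝ} (hs : s ∈ Ioc 0 (Metric.diam (simplex T))) :
    ∃ c, Metric.closedBall c (s / γ) ⊆ simplex T ∩ Metric.closedBall x s := by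
  obtain ⟨hTc, hxT⟩ := 𝒯.mem_cellsAt.1 hT
  obtain ⟨c, r, -, hball, hdiam⟩ := hγ.1 T hTc
  have hD := hs.1.trans_le hs.2
  have hγ0 : 0 < γ := two_pos.trans_le (hγ.two_le hd hTc)
  have hsub := closedBall_homothety_subset (convex_convexHull ℝ _) hxT
    (fun y hy => Metric.mem_closedBall.2 (dist_le_diam_simplex hy hxT)) hball
    (t := s / Metric.diam (simplex T)) ⟨div_pos hs.1 hD, (div_le_one hD).2 hs.2⟩
  rw [div_mul_cancel₀ _ hD.ne'] at hsub
  refine ⟨_, (Metric.closedBall_subset_closedBall ?_).trans hsub⟩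
  rw [div_mul_eq_mul_div, div_le_div_iff₀ hγ0 hD, mul_assoc, mul_comm r γ]
  exact mul_le_mul_of_nonneg_left hdiam hs.1.le

-- Shrinking the cells at `x` towards `x` turns their inscribed balls into disjoint balls of equal
-- radius in a common ball, even though the cells are not yet known to be of comparable size.
theorem ShapeRegular.card_cellsAt_le (hγ : 𝒯.ShapeRegular γ) (hd : 1 ≤ d) {x : Eu d}
    (hne : (𝒯.cellsAt x).Nonempty) : ((𝒯.cellsAt x).card : ℝ) ≤ γ ^ d := by
  obtain ⟨T₀, hT₀, hmin⟩ :=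
    (𝒯.cellsAt x).exists_min_image (fun T => Metric.diam (simplex T)) hne
  have hγ0 : 0 < γ := two_pos.trans_le (hγ.two_le hd (𝒯.cellsAt_subset x hT₀))
  set s := Metric.diam (simplex T₀)
  have hs : 0 < s := hγ.diam_pos hd (𝒯.cellsAt_subset x hT₀)
  choose! c hc using fun T hT => hγ.exists_closedBall_subset hd hT ⟨hs, hmin T hT⟩
  have hpack := card_mul_pow_le_of_closedBall_packing volume (𝒯.cellsAt x) (c := c)
    (div_nonneg hs.le hγ0.le) hs.le (fun T hT => (hc T hT).trans inter_subset_right)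
    fun T hT T' hT' hTT' =>
      (aedisjoint_simplex (𝒯.cellsAt_subset x hT) (𝒯.cellsAt_subset x hT') hTT').mono
        ((hc T hT).trans inter_subset_left) ((hc T' hT').trans inter_subset_left)
  rw [finrank_euclideanSpace_fin, div_pow, mul_div_assoc', div_le_iff₀ (by positivity),
    mul_comm (s ^ d)] at hpack
  exact le_of_mul_le_mul_right hpack (by positivity)

/-- The graph on the cells at `x` in which two cells are adjacent if they share an edge. -/
def edgeGraph (𝒯 : Triangulation Ω) (x : Eu d) : SimpleGraph (𝒯.cellsAt x) where
  Adj S S' := S ≠ S' ∧ ((S.1 : Set (Eu d)) ∩ S'.1).Nontrivial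
  symm := ⟨fun _ _ h => ⟨h.1.symm, inter_comm _ _ ▸ h.2⟩⟩
  loopless := ⟨fun _ h => h.1 rfl⟩

theorem inter_simplex_subset_singleton {x : Eu d} (hT : T ∈ 𝒯.cellsAt x) (hT' : T' ∈ 𝒯.cellsAt x)
    (hedge : ¬ ((T : Set (Eu d)) ∩ T').Nontrivial) : simplex T ∩ simplex T' ⊆ {x} := by
  obtain ⟨hTc, hx⟩ := 𝒯.mem_cellsAt.1 hT
  obtain ⟨hTc', hx'⟩ := 𝒯.mem_cellsAt.1 hT'
  have hsub := 𝒯.inter_subset_convexHull (𝒯.mem_cells.1 hTc).1 (𝒯.mem_cells.1 hTc').1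
  rcases (not_nontrivial_iff.1 hedge).eq_empty_or_singleton with h0 | ⟨v, hv⟩
  · rw [h0, convexHull_empty] at hsub
    exact absurd (hsub ⟨hx, hx'⟩) (notMem_empty x)
  · rw [hv, convexHull_singleton] at hsub
    exact fun y hy => (hsub hy).trans (hsub ⟨hx, hx'⟩).symm

theorem exists_open_inter_subset_patch (𝒯 : Triangulation Ω) (x : Eu d) :
    ∃ O : Set (Eu d), IsOpen O ∧ x ∈ O ∧ O ∩ closure Ω ⊆ 𝒯.patch x := by
  classical
  have hclosed : IsClosed (⋃ T ∈ 𝒯.cells \ 𝒯.cellsAt x, simplex T) :=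
    (Finset.isCompact_biUnion _ fun T _ => isCompact_simplex T).isClosed
  refine ⟨_, hclosed.isOpen_compl, fun hx => ?_, fun y ⟨hyO, hy⟩ => ?_⟩
  · obtain ⟨T, hT, hxT⟩ := mem_iUnion₂.1 hx
    obtain ⟨hTc, hTx⟩ := Finset.mem_sdiff.1 hT
    exact hTx (𝒯.mem_cellsAt.2 ⟨hTc, hxT⟩)
  · rw [𝒯.closure_eq] at hy
    obtain ⟨T, hT, hyT⟩ := mem_iUnion₂.1 hy
    refine mem_iUnion₂.2 ⟨T, ?_, hyT⟩
    by_contra hTx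
    exact hyO (mem_iUnion₂.2 ⟨T, Finset.mem_sdiff.2 ⟨hT, hTx⟩, hyT⟩)

theorem exists_preconnected_link_of_mem (hΩ : IsOpen Ω) (hd : 2 ≤ d) {x : Eu d} (hx : x ∈ Ω) :
    ∃ W : Set (Eu d), IsPreconnected W ∧ x ∉ W ∧ W ⊆ 𝒯.patch x ∧
      ∀ T ∈ 𝒯.cellsAt x, (W ∩ simplex T).Nonempty := by
  obtain ⟨O, hO, hxO, hpatch⟩ := 𝒯.exists_open_inter_subset_patch x
  obtain ⟨ε, hε, hball⟩ := Metric.isOpen_iff.1 (hO.inter hΩ) x ⟨hxO, hx⟩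
  have hrank : 1 < Module.rank ℝ (Eu d) := by
    rw [← Module.finrank_eq_rank, finrank_euclideanSpace_fin]
    exact_mod_cast hd
  have hmeet : ∀ᶠ ρ : ℝ in 𝓝[>] 0, ∀ T ∈ 𝒯.cellsAt x, (Metric.sphere x ρ ∩ simplex T).Nonempty := by
    rw [Filter.eventually_all_finset]
    intro T hT
    obtain ⟨hTc, hxT⟩ := 𝒯.mem_cellsAt.1 hT
    obtain ⟨v, hv, w, hw, hvw⟩ := exists_ne_vertices (by lia) hTc
    refine eventually_nonempty_sphere_inter (convex_convexHull ℝ _) hxT ?_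
    exact (nontrivial_of_mem_mem_ne (vertex_mem_simplex hv) (vertex_mem_simplex hw) hvw).exists_ne x
  obtain ⟨ρ, hρ, hρε⟩ := (hmeet.and (Ioo_mem_nhdsGT hε)).exists
  refine ⟨Metric.sphere x ρ, isPreconnected_sphere hrank x ρ, ?_, fun y hy => ?_, hρ⟩
  · simpa using hρε.1.ne
  · have hyΩ := hball (Metric.sphere_subset_ball hρε.2 hy)
    exact hpatch ⟨hyΩ.1, subset_closure hyΩ.2⟩

theorem exists_preconnected_link_of_mem_frontier (hΩ : interior (closure Ω) = Ω)
    (hconn : LocallyConnectedAtFrontier Ω) {x : Eu d} (hx : x ∈ frontier Ω) :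
    ∃ W : Set (Eu d), IsPreconnected W ∧ x ∉ W ∧ W ⊆ 𝒯.patch x ∧
      ∀ T ∈ 𝒯.cellsAt x, (W ∩ simplex T).Nonempty := by
  have hxΩ : x ∉ Ω := fun h => hx.2 ((hΩ ▸ isOpen_interior : IsOpen Ω).interior_eq.symm ▸ h)
  obtain ⟨O, hO, hxO, hpatch⟩ := 𝒯.exists_open_inter_subset_patch x
  obtain ⟨V, hVO, hV, hxV, hVΩ⟩ := hconn x hx O (hO.mem_nhds hxO)
  refine ⟨V ∩ Ω, hVΩ.isPreconnected, fun h => hxΩ h.2,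
    fun y hy => hpatch ⟨hVO hy.1, subset_closure hy.2⟩, fun T hT => ?_⟩
  obtain ⟨hTc, hxT⟩ := 𝒯.mem_cellsAt.1 hT
  have hconv : Convex ℝ (simplex T) := convex_convexHull ℝ _
  have hcl : x ∈ closure (interior (simplex T)) := by
    rw [hconv.closure_interior_eq_closure_of_nonempty_interior
      (interior_simplex_nonempty hTc)]
    exact subset_closure hxT
  obtain ⟨y, hyV, hyT⟩ := mem_closure_iff.1 hcl V hV hxV
  exact ⟨y, ⟨hyV, interior_simplex_subset hΩ hTc hyT⟩, interior_subset hyT⟩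

theorem edgeGraph_preconnected (hΩ : interior (closure Ω) = Ω)
    (hconn : LocallyConnectedAtFrontier Ω) (hd : 2 ≤ d) {x : Eu d} (hx : x ∈ closure Ω) :
    (𝒯.edgeGraph x).Preconnected := by
  have hopen : IsOpen Ω := hΩ ▸ isOpen_interior
  obtain ⟨W, hW, hxW, hpatch, hmeet⟩ : ∃ W : Set (Eu d), IsPreconnected W ∧ x ∉ W ∧
      W ⊆ 𝒯.patch x ∧ ∀ T ∈ 𝒯.cellsAt x, (W ∩ simplex T).Nonempty := by
    by_cases hxΩ : x ∈ Ω
    · exact exists_preconnected_link_of_mem hopen hd hxΩ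
    · exact exists_preconnected_link_of_mem_frontier hΩ hconn (hopen.frontier_eq ▸ ⟨hx, hxΩ⟩)
  refine preconnected_of_finite_closed_cover (S := fun R : 𝒯.cellsAt x => simplex R.1)
    (fun R => (isCompact_simplex R.1).isClosed) hW (fun y hy => ?_) (fun R => hmeet R.1 R.2)
    fun R R' hne ⟨y, hyW, hy⟩ => ⟨hne, ?_⟩
  · obtain ⟨R, hR, hyR⟩ := mem_iUnion₂.1 (hpatch hy)
    exact mem_iUnion.2 ⟨⟨R, hR⟩, hyR⟩
  · by_contra hedge
    exact hxW (inter_simplex_subset_singleton R.2 R'.2 hedge hy ▸ hyW)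

theorem ShapeRegular.diam_le_of_walk (hγ : 𝒯.ShapeRegular γ) (hd : 1 ≤ d) {x : Eu d}
    {S S' : 𝒯.cellsAt x} (p : (𝒯.edgeGraph x).Walk S S') :
    Metric.diam (simplex S.1) ≤ γ ^ p.length * Metric.diam (simplex S'.1) := by
  induction p with
  | nil => simp
  | @cons S R S' hadj p ih =>
    have hS := 𝒯.cellsAt_subset x S.2
    rw [SimpleGraph.Walk.length_cons, pow_succ', mul_assoc]
    exact (hγ.diam_le_of_common_edge hd hS hadj.2).trans
      (mul_le_mul_of_nonneg_left ih (zero_le_two.trans (hγ.two_le hd hS)))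

theorem ShapeRegular.diam_le_diam (hγ : 𝒯.ShapeRegular γ) (hΩ : interior (closure Ω) = Ω)
    (hconn : LocallyConnectedAtFrontier Ω) (hd : 1 ≤ d) {x : Eu d} (hT : T ∈ 𝒯.cellsAt x)
    (hT' : T' ∈ 𝒯.cellsAt x) :
    Metric.diam (simplex T) ≤ γ ^ (⌊γ ^ d⌋₊ + 1) * Metric.diam (simplex T') := by
  obtain ⟨hTc, hxT⟩ := 𝒯.mem_cellsAt.1 hT
  obtain ⟨hTc', hxT'⟩ := 𝒯.mem_cellsAt.1 hT'
  have hγ1 : 1 ≤ γ := one_le_two.trans (hγ.two_le hd hTc)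
  obtain ⟨n, hn, hdiam⟩ : ∃ n ≤ ⌊γ ^ d⌋₊ + 1,
      Metric.diam (simplex T) ≤ γ ^ n * Metric.diam (simplex T') := by
    rcases hd.eq_or_lt with hd1 | hd2
    · exact ⟨1, by lia, by simpa using hγ.2 hd1.symm T hTc T' hTc' ⟨x, hxT, hxT'⟩⟩
    · classical
      obtain ⟨p, hp⟩ := (edgeGraph_preconnected hΩ hconn hd2 (simplex_subset_closure hTc hxT)
        ⟨T, hT⟩ ⟨T', hT'⟩).exists_isPath
      refine ⟨p.length, ?_, hγ.diam_le_of_walk hd p⟩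
      have hlen := hp.length_lt
      rw [Fintype.card_coe] at hlen
      have hcard := Nat.le_floor (hγ.card_cellsAt_le hd ⟨T, hT⟩)
      exact hlen.le.trans (hcard.trans (Nat.le_succ _))
  exact hdiam.trans (mul_le_mul_of_nonneg_right (pow_le_pow_right₀ hγ1 hn) Metric.diam_nonneg)

theorem ShapeRegular.diam_patch_le (hγ : 𝒯.ShapeRegular γ) (hΩ : interior (closure Ω) = Ω)
    (hconn : LocallyConnectedAtFrontier Ω) (hd : 1 ≤ d) {x : Eu d} (hT : T ∈ 𝒯.cellsAt x) :
    Metric.diam (𝒯.patch x) ≤ 2 * γ ^ (⌊γ ^ d⌋₊ + 1) * Metric.diam (simplex T) := by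
  have hγ2 := hγ.two_le hd (𝒯.cellsAt_subset x hT)
  rw [mul_assoc]
  refine Metric.diam_le_of_subset_closedBall (x := x) (by positivity) fun y hy => ?_
  obtain ⟨S, hS, hyS⟩ := mem_iUnion₂.1 hy
  exact (dist_le_diam_simplex hyS (𝒯.mem_cellsAt.1 hS).2).trans
    (hγ.diam_le_diam hΩ hconn hd hS hT)

end ShapeRegularity

section BernsteinBasis

open MvPolynomial

variable {d k : ℕ} {Ω : Set (Eu d)} {𝒯 : Triangulation Ω} {T T' : Finset (Eu d)} {i : Eu d}

theorem isPolyOn_bernstein (hk : 1 ≤ k) (hi : i ∈ 𝒯.nodes k) (hT : T ∈ 𝒯.cells) :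
    IsPolyOn k (simplex T) (𝒯.bernstein k i) := by
  by_cases hiT : i ∈ simplex T
  · have hTi := 𝒯.mem_cellsAt.2 ⟨hT, hiT⟩
    have hdeg : (bernPoly (𝒯.nodeIndex k T i)).totalDegree ≤ k :=
      (isHomogeneous_bernPoly (Finset.mem_piAntidiag.1 (nodeIndex_mem hk hi hTi)).1).totalDegree_le
    exact ((isPolyOn_eval_coords (𝒯.basis T) _ _).mono hdeg).congr
      fun x hx => bernstein_eq_eval hTi hx
  · exact ⟨0, by simp, fun x hx => by rw [bernstein_eq_zero hk hi hT hiT hx, map_zero]⟩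

theorem continuousOn_closure {m : ℕ} {f : Eu d → ℝ}
    (hf : ∀ T ∈ 𝒯.cells, IsPolyOn m (simplex T) f) : ContinuousOn f (closure Ω) := by
  obtain ⟨K, hK⟩ := exists_lipschitzOnWith_simplex hf
  rw [𝒯.closure_eq]
  exact continuousOn_biUnion_simplex hK

theorem setIntegral_simplex_eval_coords (hT : T ∈ 𝒯.cells)
    (p : MvPolynomial (Fin (d + 1)) ℝ) :
    ∫ x in simplex T, eval ((𝒯.basis T).coords x) p = volume.real (simplex T) * refMean d p := by
  rw [← hull_basis hT]
  exact integral_hull_eval_coords _ p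

theorem refMean_bernPoly_nodeIndex_eq (hT : T ∈ 𝒯.cellsAt i) (hT' : T' ∈ 𝒯.cellsAt i) :
    refMean d (bernPoly (𝒯.nodeIndex k T i)) = refMean d (bernPoly (𝒯.nodeIndex k T' i)) := by
  obtain ⟨hTc, hiT⟩ := 𝒯.mem_cellsAt.1 hT
  obtain ⟨hTc', hiT'⟩ := 𝒯.mem_cellsAt.1 hT'
  obtain ⟨σ, -, hσ⟩ := exists_perm_nodeIndex (k := k) hTc hTc'
  rw [hσ i ⟨hiT, hiT'⟩, ← refMean_rename σ, rename_bernPoly_comp]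

theorem setIntegral_eq_sum_cellsAt (hΩ : interior (closure Ω) = Ω) {f : Eu d → ℝ}
    (hf : ContinuousOn f (closure Ω))
    (hzero : ∀ T ∈ 𝒯.cells, i ∉ simplex T → ∀ x ∈ simplex T, f x = 0) :
    ∫ x in Ω, f x = ∑ T ∈ 𝒯.cellsAt i, ∫ x in simplex T, f x := by
  rw [setIntegral_eq_sum hΩ 𝒯 hf]
  refine (Finset.sum_subset (𝒯.cellsAt_subset i) fun T hT hTi => ?_).symm
  exact setIntegral_eq_zero_of_forall_eq_zero
    (hzero T hT fun hiT => hTi (𝒯.mem_cellsAt.2 ⟨hT, hiT⟩))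

theorem integral_bernstein (hΩ : interior (closure Ω) = Ω) (hk : 1 ≤ k) (hi : i ∈ 𝒯.nodes k)
    (hT : T ∈ 𝒯.cellsAt i) :
    ∫ x in Ω, 𝒯.bernstein k i x =
      volume.real (𝒯.patch i) * refMean d (bernPoly (𝒯.nodeIndex k T i)) := by
  rw [setIntegral_eq_sum_cellsAt hΩ
    (continuousOn_closure fun S hS => isPolyOn_bernstein hk hi hS)
    fun S hS hiS x hx => bernstein_eq_zero hk hi hS hiS hx, volume_patch, Finset.sum_mul]
  refine Finset.sum_congr rfl fun S hS => ?_
  rw [← refMean_bernPoly_nodeIndex_eq hS hT,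
    ← setIntegral_simplex_eval_coords (𝒯.cellsAt_subset i hS)]
  exact setIntegral_congr_fun (isCompact_simplex S).measurableSet
    fun x hx => bernstein_eq_eval hS hx

end BernsteinBasis

section DualFunctions

open MvPolynomial
open scoped NNReal

variable {d : ℕ} {Ω : Set (Eu d)}

open Classical in
/-- The factor `ζ_i` of the dual function `ψ_i = b_i ζ_i`: on each cell that contains `i` it is
the polynomial `Z α` in the barycentric coordinates, divided by `|ω_i|`, where `α` is the
multi-index of `i`. For equivariant `Z` the value does not depend on the chosen cell. -/
def dualFactor (𝒯 : Triangulation Ω) (k : ℕ)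
    (Z : (Fin (d + 1) → ℕ) → MvPolynomial (Fin (d + 1)) ℝ) (i x : Eu d) : ℝ :=
  if h : ∃ T ∈ 𝒯.cellsAt i, x ∈ simplex T then
    (volume.real (𝒯.patch i))⁻¹ *
      eval ((𝒯.basis h.choose).coords x) (Z (𝒯.nodeIndex k h.choose i))
  else 0

/-- The dual function `ψ_i` built from the local polynomials `Z`. -/
def dualFunction (𝒯 : Triangulation Ω) (k : ℕ)
    (Z : (Fin (d + 1) → ℕ) → MvPolynomial (Fin (d + 1)) ℝ) (i x : Eu d) : ℝ :=
  𝒯.bernstein k i x * 𝒯.dualFactor k Z i x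

variable {𝒯 : Triangulation Ω} {T : Finset (Eu d)} {k : ℕ} {i j x : Eu d}
  {Z : (Fin (d + 1) → ℕ) → MvPolynomial (Fin (d + 1)) ℝ}

theorem dualFactor_eq (hZ : IsEquivariant Z) (hT : T ∈ 𝒯.cellsAt i) (hx : x ∈ simplex T) :
    𝒯.dualFactor k Z i x = (volume.real (𝒯.patch i))⁻¹ *
      eval ((𝒯.basis T).coords x) (Z (𝒯.nodeIndex k T i)) := by
  have h : ∃ T ∈ 𝒯.cellsAt i, x ∈ simplex T := ⟨T, hT, hx⟩
  rw [dualFactor, dif_pos h]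
  obtain ⟨hS, hxS⟩ := h.choose_spec
  generalize h.choose = S at hS hxS
  obtain ⟨hTc, hiT⟩ := 𝒯.mem_cellsAt.1 hT
  obtain ⟨hSc, hiS⟩ := 𝒯.mem_cellsAt.1 hS
  obtain ⟨σ, hcoords, hindex⟩ := exists_perm_nodeIndex (k := k) hTc hSc
  rw [hcoords x ⟨hx, hxS⟩, hindex i ⟨hiT, hiS⟩, ← eval_rename, hZ σ]

theorem dualFunction_eq (hZ : IsEquivariant Z) (hT : T ∈ 𝒯.cellsAt i) (hx : x ∈ simplex T) :
    𝒯.dualFunction k Z i x = (volume.real (𝒯.patch i))⁻¹ *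
      eval ((𝒯.basis T).coords x) (bernPoly (𝒯.nodeIndex k T i) * Z (𝒯.nodeIndex k T i)) := by
  rw [dualFunction, dualFactor_eq hZ hT hx, bernstein_eq_eval hT hx, map_mul, mul_left_comm]

theorem dualFunction_eq_zero (hk : 1 ≤ k) (hi : i ∈ 𝒯.nodes k) (hT : T ∈ 𝒯.cells)
    (hiT : i ∉ simplex T) (hx : x ∈ simplex T) : 𝒯.dualFunction k Z i x = 0 := by
  rw [dualFunction, bernstein_eq_zero hk hi hT hiT hx, zero_mul]

theorem isPolyOn_dualFactor (hZ : IsEquivariant Z) (hdual : IsLocalDualBasis (refMean d) k Z)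
    (hk : 1 ≤ k) (hi : i ∈ 𝒯.nodes k) (hT : T ∈ 𝒯.cellsAt i) :
    IsPolyOn (2 * k) (simplex T) (𝒯.dualFactor k Z i) := by
  have hdeg := (totalDegree_smul_le (volume.real (𝒯.patch i))⁻¹ _).trans
    (hdual.totalDegree_le _ (nodeIndex_mem hk hi hT))
  exact ((isPolyOn_eval_coords (𝒯.basis T) _ _).mono hdeg).congr fun x hx => by
    rw [dualFactor_eq hZ hT hx, smul_eval]

theorem isPolyOn_dualFunction (hZ : IsEquivariant Z) (hdual : IsLocalDualBasis (refMean d) k Z)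
    (hk : 1 ≤ k) (hi : i ∈ 𝒯.nodes k) (hT : T ∈ 𝒯.cells) :
    IsPolyOn (3 * k) (simplex T) (𝒯.dualFunction k Z i) := by
  by_cases hiT : i ∈ simplex T
  · have hfactor := isPolyOn_dualFactor hZ hdual hk hi (𝒯.mem_cellsAt.2 ⟨hT, hiT⟩)
    exact ((isPolyOn_bernstein hk hi hT).mul hfactor).mono (by lia)
  · exact ⟨0, by simp, fun x hx => by rw [dualFunction_eq_zero hk hi hT hiT hx, map_zero]⟩

theorem continuousOn_bernstein_mul_dualFunction (hZ : IsEquivariant Z)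
    (hdual : IsLocalDualBasis (refMean d) k Z) (hk : 1 ≤ k) (hi : i ∈ 𝒯.nodes k)
    (hj : j ∈ 𝒯.nodes k) :
    ContinuousOn (fun x => 𝒯.bernstein k i x * 𝒯.dualFunction k Z j x) (closure Ω) :=
  continuousOn_closure fun _ hT =>
    (isPolyOn_bernstein hk hi hT).mul (isPolyOn_dualFunction hZ hdual hk hj hT)

theorem integrableOn_bernstein_mul_dualFunction (hZ : IsEquivariant Z)
    (hdual : IsLocalDualBasis (refMean d) k Z) (hk : 1 ≤ k) (hi : i ∈ 𝒯.nodes k)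
    (hj : j ∈ 𝒯.nodes k) :
    IntegrableOn (fun x => 𝒯.bernstein k i x * 𝒯.dualFunction k Z j x) Ω :=
  ((continuousOn_bernstein_mul_dualFunction hZ hdual hk hi hj).integrableOn_compact
    𝒯.isCompact_closure).mono_set subset_closure

theorem setIntegral_simplex_bernstein_mul_dualFunction (hZ : IsEquivariant Z)
    (hdual : IsLocalDualBasis (refMean d) k Z) (hk : 1 ≤ k) (hi : i ∈ 𝒯.nodes k)
    (hj : j ∈ 𝒯.nodes k) (hT : T ∈ 𝒯.cellsAt j) :
    ∫ x in simplex T, 𝒯.bernstein k i x * 𝒯.dualFunction k Z j x =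
      (volume.real (𝒯.patch j))⁻¹ * (volume.real (simplex T) * indicator {i} 1 j) := by
  obtain ⟨hTc, hjT⟩ := 𝒯.mem_cellsAt.1 hT
  by_cases hiT : i ∈ simplex T
  · have hTi := 𝒯.mem_cellsAt.2 ⟨hTc, hiT⟩
    have hlocal : ∫ x in simplex T, 𝒯.bernstein k i x * 𝒯.dualFunction k Z j x =
        ∫ x in simplex T, (volume.real (𝒯.patch j))⁻¹ * eval ((𝒯.basis T).coords x)
          (bernPoly (𝒯.nodeIndex k T i) *
            (bernPoly (𝒯.nodeIndex k T j) * Z (𝒯.nodeIndex k T j))) :=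
      setIntegral_congr_fun (isCompact_simplex T).measurableSet fun x hx => by
        simp only [dualFunction_eq hZ hT hx, bernstein_eq_eval hTi hx,
          map_mul (eval _) (bernPoly (𝒯.nodeIndex k T i)), mul_left_comm]
    rw [hlocal, integral_const_mul, setIntegral_simplex_eval_coords hTc,
      hdual.biorthogonal _ (nodeIndex_mem hk hj hT) _ (nodeIndex_mem hk hi hTi)]
    simp only [(injOn_nodeIndex hk T).eq_iff ⟨hj, hT⟩ ⟨hi, hTi⟩, indicator_apply,
      mem_singleton_iff, Pi.one_apply]
  · have hji : j ∉ ({i} : Set (Eu d)) := fun h => hiT (mem_singleton_iff.1 h ▸ hjT)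
    rw [indicator_of_notMem hji, mul_zero, mul_zero]
    exact setIntegral_eq_zero_of_forall_eq_zero fun x hx => by
      rw [bernstein_eq_zero hk hi hTc hiT hx, zero_mul]

theorem integral_bernstein_mul_dualFunction (hZ : IsEquivariant Z)
    (hdual : IsLocalDualBasis (refMean d) k Z) (hΩ : interior (closure Ω) = Ω) (hk : 1 ≤ k)
    (hi : i ∈ 𝒯.nodes k) (hj : j ∈ 𝒯.nodes k) :
    ∫ x in Ω, 𝒯.bernstein k i x * 𝒯.dualFunction k Z j x = indicator {i} 1 j := by
  obtain ⟨T₀, hT₀, -⟩ := exists_cellsAt_of_node hk hj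
  rw [setIntegral_eq_sum_cellsAt hΩ (continuousOn_bernstein_mul_dualFunction hZ hdual hk hi hj)
      fun T hT hjT x hx => by rw [dualFunction_eq_zero hk hj hT hjT hx, mul_zero],
    Finset.sum_congr rfl fun T hT =>
      setIntegral_simplex_bernstein_mul_dualFunction hZ hdual hk hi hj hT,
    ← Finset.mul_sum, ← Finset.sum_mul, ← volume_patch,
    inv_mul_cancel_left₀ (volume_patch_pos hT₀).ne']

theorem sum_integral_bernstein_mul_dualFunction (hZ : IsEquivariant Z)
    (hdual : IsLocalDualBasis (refMean d) k Z) (hΩ : interior (closure Ω) = Ω) (hk : 1 ≤ k)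
    (hx : x ∈ closure Ω) :
    ∑ i ∈ 𝒯.nodes k, (∫ y in Ω, 𝒯.bernstein k i y) * 𝒯.dualFunction k Z i x = 1 := by
  classical
  rw [𝒯.closure_eq] at hx
  obtain ⟨T, hT, hxT⟩ := mem_iUnion₂.1 hx
  have hterm : ∀ i ∈ 𝒯.nodes k, T ∈ 𝒯.cellsAt i →
      (∫ y in Ω, 𝒯.bernstein k i y) * 𝒯.dualFunction k Z i x =
        refMean d (bernPoly (𝒯.nodeIndex k T i)) *
          (eval ((𝒯.basis T).coords x) (bernPoly (𝒯.nodeIndex k T i)) *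
            eval ((𝒯.basis T).coords x) (Z (𝒯.nodeIndex k T i))) := fun i hi hTi => by
    have hV := (volume_patch_pos hTi).ne'
    rw [integral_bernstein hΩ hk hi hTi, dualFunction_eq hZ hTi hxT, map_mul]
    field_simp
  rw [← hdual.mass _ (coords_mem hT hxT),
    ← Finset.sum_filter_of_ne (p := fun i => T ∈ 𝒯.cellsAt i)]
  · refine Finset.sum_nbij (𝒯.nodeIndex k T) (fun i hi => ?_) ?_ (fun α hα => ?_) fun i hi => ?_
    · exact nodeIndex_mem hk (Finset.mem_filter.1 hi).1 (Finset.mem_filter.1 hi).2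
    · exact (injOn_nodeIndex hk T).mono fun i hi => Finset.mem_filter.1 hi
    · obtain ⟨i, hi, hTi, hiα⟩ := exists_nodeIndex_eq hk hT hα
      exact ⟨i, Finset.mem_filter.2 ⟨hi, hTi⟩, hiα⟩
    · exact hterm i (Finset.mem_filter.1 hi).1 (Finset.mem_filter.1 hi).2
  · intro i hi hne
    by_contra hTi
    exact hne (by rw [dualFunction_eq_zero hk hi hT (fun h => hTi (𝒯.mem_cellsAt.2 ⟨hT, h⟩)) hxT,
      mul_zero])

theorem eLpNorm_dualFunction_le (hZ : IsEquivariant Z) {B : ℝ}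
    (hB : ∀ α ∈ Finset.univ.piAntidiag k, ∀ x ∈ stdSimplex ℝ (Fin (d + 1)),
      ‖eval x (bernPoly α * Z α)‖ ≤ B) (hk : 1 ≤ k) (hi : i ∈ 𝒯.nodes k) :
    eLpNorm (𝒯.dualFunction k Z i) ∞ (volume.restrict (𝒯.patch i)) ≤
      ENNReal.ofReal (B * (volume.real (𝒯.patch i))⁻¹) := by
  rw [eLpNorm_exponent_top]
  refine eLpNormEssSup_le_of_ae_bound ?_
  refine ae_restrict_of_forall_mem (isCompact_patch i).measurableSet fun x hx => ?_
  obtain ⟨T, hT, hxT⟩ := mem_iUnion₂.1 hx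
  rw [dualFunction_eq hZ hT hxT, norm_mul, Real.norm_of_nonneg (by positivity), mul_comm]
  exact mul_le_mul_of_nonneg_right
    (hB _ (nodeIndex_mem hk hi hT) _ (coords_mem (𝒯.cellsAt_subset i hT) hxT)) (by positivity)

theorem ShapeRegular.lipschitzWith_coords {γ : ℝ} (hγ : 𝒯.ShapeRegular γ)
    (hΩ : interior (closure Ω) = Ω) (hconn : LocallyConnectedAtFrontier Ω) (hd : 1 ≤ d)
    (hT : T ∈ 𝒯.cellsAt i) :
    LipschitzWith (Real.toNNReal (γ ^ (⌊γ ^ d⌋₊ + 2) * (Metric.diam (𝒯.patch i))⁻¹))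
      (𝒯.basis T).coords := by
  have hTc := 𝒯.cellsAt_subset i hT
  obtain ⟨c, r, hr, hball, hdiam⟩ := hγ.1 T hTc
  have hγ2 := hγ.two_le hd hTc
  have hD : 0 < Metric.diam (𝒯.patch i) := (hγ.diam_pos hd hTc).trans_le <|
    Metric.diam_mono (subset_biUnion_of_mem (u := fun T => simplex T) hT)
      (isCompact_patch i).isBounded
  have hDr : Metric.diam (𝒯.patch i) ≤ γ ^ (⌊γ ^ d⌋₊ + 2) * (2 * r) := by
    calc Metric.diam (𝒯.patch i)
        ≤ 2 * γ ^ (⌊γ ^ d⌋₊ + 1) * Metric.diam (simplex T) := hγ.diam_patch_le hΩ hconn hd hT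
      _ ≤ 2 * γ ^ (⌊γ ^ d⌋₊ + 1) * (γ * r) := mul_le_mul_of_nonneg_left hdiam (by positivity)
      _ = γ ^ (⌊γ ^ d⌋₊ + 2) * (2 * r) := by ring
  refine (Triangulation.lipschitzWith_coords hTc hr hball).weaken (Real.toNNReal_le_toNNReal ?_)
  rwa [← div_eq_mul_inv, le_div_iff₀ hD, inv_mul_le_iff₀ (by positivity), mul_comm]

theorem lipschitzOnWith_dualFunction (hZ : IsEquivariant Z) {L Λ : ℝ≥0}
    (hL : ∀ α ∈ Finset.univ.piAntidiag k,
      LipschitzOnWith L (fun x => eval x (bernPoly α * Z α)) (stdSimplex ℝ (Fin (d + 1))))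
    (hk : 1 ≤ k) (hi : i ∈ 𝒯.nodes k) (hT : T ∈ 𝒯.cellsAt i)
    (hΛ : LipschitzWith Λ (𝒯.basis T).coords) :
    LipschitzOnWith (Real.toNNReal (volume.real (𝒯.patch i))⁻¹ * (L * Λ))
      (𝒯.dualFunction k Z i) (simplex T) := by
  have hcomp := (hL _ (nodeIndex_mem hk hi hT)).comp hΛ.lipschitzOnWith
    fun x hx => coords_mem (𝒯.cellsAt_subset i hT) hx
  refine LipschitzOnWith.of_dist_le_mul fun y hy z hz => ?_
  rw [dualFunction_eq hZ hT hy, dualFunction_eq hZ hT hz, Real.dist_eq, ← mul_sub, abs_mul,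
    abs_of_nonneg (by positivity), NNReal.coe_mul, Real.coe_toNNReal _ (by positivity), mul_assoc]
  exact mul_le_mul_of_nonneg_left (hcomp.dist_le_mul y hy z hz) (by positivity)

theorem ae_mem_interior_simplex (𝒯 : Triangulation Ω) (i : Eu d) :
    ∀ᵐ x ∂volume.restrict (𝒯.patch i), ∃ T ∈ 𝒯.cellsAt i, x ∈ interior (simplex T) := by
  rw [ae_restrict_iff' (isCompact_patch i).measurableSet]
  have hnull : ∀ᵐ x : Eu d, ∀ T ∈ 𝒯.cellsAt i, x ∉ frontier (simplex T) := by
    rw [Filter.eventually_all_finset]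
    exact fun T _ => measure_eq_zero_iff_ae_notMem.1 (frontier_simplex_null T)
  filter_upwards [hnull] with x hx hxp
  obtain ⟨T, hT, hxT⟩ := mem_iUnion₂.1 hxp
  exact ⟨T, hT, not_not.1 fun hint => hx T hT ⟨subset_closure hxT, hint⟩⟩

theorem eLpNorm_gradient_dualFunction_le (hZ : IsEquivariant Z) {L : ℝ≥0}
    (hL : ∀ α ∈ Finset.univ.piAntidiag k,
      LipschitzOnWith L (fun x => eval x (bernPoly α * Z α)) (stdSimplex ℝ (Fin (d + 1))))
    (hk : 1 ≤ k) (hi : i ∈ 𝒯.nodes k) (hd : 1 ≤ d) (hΩ : interior (closure Ω) = Ω)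
    (hconn : LocallyConnectedAtFrontier Ω) {γ : ℝ} (hγ : 𝒯.ShapeRegular γ) :
    eLpNorm (gradient (𝒯.dualFunction k Z i)) ∞ (volume.restrict (𝒯.patch i)) ≤
      ENNReal.ofReal (L * γ ^ (⌊γ ^ d⌋₊ + 2) * (Metric.diam (𝒯.patch i))⁻¹ *
        (volume.real (𝒯.patch i))⁻¹) := by
  rw [eLpNorm_exponent_top]
  refine eLpNormEssSup_le_of_ae_bound ?_
  filter_upwards [𝒯.ae_mem_interior_simplex i] with x ⟨T, hT, hxT⟩
  have hγ2 := hγ.two_le hd (𝒯.cellsAt_subset i hT)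
  have hlip := lipschitzOnWith_dualFunction hZ hL hk hi hT
    (hγ.lipschitzWith_coords hΩ hconn hd hT)
  rw [norm_gradient]
  refine (norm_fderiv_le_of_lipschitzOn ℝ (mem_interior_iff_mem_nhds.1 hxT) hlip).trans_eq ?_
  rw [NNReal.coe_mul, NNReal.coe_mul, Real.coe_toNNReal _ (by positivity),
    Real.coe_toNNReal _ (by positivity)]
  ring

end DualFunctions

end Triangulation

end LagrangeFE

end

open LagrangeFE Triangulation in
theorem proposition2p7_general (d k : ℕ) (hd : 1 ≤ d) (hk : 1 ≤ k) :
    ∃ (C₁ : ℝ) (C₂ : ℝ → ℝ),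
      ∀ (Ω : Set (Eu d)), interior (closure Ω) = Ω →
      ∀ 𝒯 : Triangulation Ω,
      ∃ ψ : Eu d → Eu d → ℝ,
        (∀ i ∈ 𝒯.nodes k,
          ψ i ∈ lagrangeSpace Ω 𝒯.cells (3 * k) ∧ ContinuousOn (ψ i) (closure Ω)) ∧
        (∀ i ∈ 𝒯.nodes k,
          (∃ ζ ∈ lagrangeSpace (interior (𝒯.patch i)) (𝒯.cellsAt i) (2 * k),
            ∀ x, ψ i x = 𝒯.bernstein k i x * ζ x) ∧
          tsupport (ψ i) ⊆ tsupport (𝒯.bernstein k i)) ∧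
        (∀ i ∈ 𝒯.nodes k, ∀ j ∈ 𝒯.nodes k,
          IntegrableOn (fun x => 𝒯.bernstein k i x * ψ j x) Ω ∧
          ∫ x in Ω, 𝒯.bernstein k i x * ψ j x = Set.indicator {i} 1 j) ∧
        (∀ i ∈ 𝒯.nodes k,
          eLpNorm (ψ i) ∞ (volume.restrict (𝒯.patch i)) ≤
            ENNReal.ofReal (C₁ * (volume.real (𝒯.patch i))⁻¹)) ∧
        (LocallyConnectedAtFrontier Ω → ∀ γ : ℝ, 𝒯.ShapeRegular γ → ∀ i ∈ 𝒯.nodes k,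
          ∃ g : Eu d → Eu d,
            IntegrableOn g Ω ∧ HasWeakGradient Ω (ψ i) g ∧
            eLpNorm g ∞ (volume.restrict (𝒯.patch i)) ≤
              ENNReal.ofReal
                (C₂ γ * (Metric.diam (𝒯.patch i))⁻¹ * (volume.real (𝒯.patch i))⁻¹)) ∧
        (∀ x ∈ closure Ω,
          ∑ i ∈ 𝒯.nodes k, (∫ y in Ω, 𝒯.bernstein k i y) * ψ i x = 1) := by
  obtain ⟨Z, hdual, hZ⟩ :=
    exists_isEquivariant_isLocalDualBasis (isStrictlyPositive_refMean d) refMean_rename k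
  have hΔ := isCompact_stdSimplex ℝ (Fin (d + 1))
  let indices : Finset (Fin (d + 1) → ℕ) := Finset.univ.piAntidiag k
  obtain ⟨B, hB⟩ := exists_norm_le_of_continuousOn (s := indices) hΔ
    fun α _ => (MvPolynomial.continuous_eval (bernPoly α * Z α)).continuousOn
  obtain ⟨L, hL⟩ := exists_lipschitzOnWith_of_forall (s := indices)
    fun α _ => exists_lipschitzOnWith_eval hΔ (bernPoly α * Z α)
  refine ⟨B, fun γ => L * γ ^ (⌊γ ^ d⌋₊ + 2), fun Ω hΩ 𝒯 => ⟨𝒯.dualFunction k Z, ?_⟩⟩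
  have hopen : IsOpen Ω := hΩ ▸ isOpen_interior
  have hcov := 𝒯.subset_biUnion_cells
  have hpoly : ∀ i ∈ 𝒯.nodes k, ∀ T ∈ 𝒯.cells,
      IsPolyOn (3 * k) (simplex T) (𝒯.dualFunction k Z i) :=
    fun i hi T hT => isPolyOn_dualFunction hZ hdual hk hi hT
  refine ⟨fun i hi => ⟨mem_lagrangeSpace hopen hcov (hpoly i hi),
      continuousOn_closure (hpoly i hi)⟩,
    fun i hi => ⟨⟨𝒯.dualFactor k Z i, ?_, fun _ => rfl⟩,
      closure_mono (Function.support_mul_subset_left _ _)⟩,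
    fun i hi j hj => ⟨integrableOn_bernstein_mul_dualFunction hZ hdual hk hi hj,
      integral_bernstein_mul_dualFunction hZ hdual hΩ hk hi hj⟩,
    fun i hi => eLpNorm_dualFunction_le hZ hB hk hi, fun hconn γ hγ i hi => ?_,
    fun x hx => sum_integral_bernstein_mul_dualFunction hZ hdual hΩ hk hx⟩
  · exact mem_lagrangeSpace isOpen_interior interior_subset
      fun T hT => isPolyOn_dualFactor hZ hdual hk hi hT
  · obtain ⟨hint, hweak⟩ := hasWeakGradient_of_isPolyOn_simplex hopen hcov (hpoly i hi)
    exact ⟨_, hint, hweak, eLpNorm_gradient_dualFunction_le hZ hL hk hi hd hΩ hconn hγ⟩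

theorem proposition2p7 (d k : ℕ) (hd : 1 ≤ d) (hk : 1 ≤ k) :
    ∃ (C₁ : ℝ) (C₂ : ℝ → ℝ),
      ∀ (Ω : Set (LagrangeFE.Eu d)), LagrangeFE.IsPolyhedralDomain Ω →
      ∀ 𝒯 : LagrangeFE.Triangulation Ω,
      ∃ ψ : LagrangeFE.Eu d → LagrangeFE.Eu d → ℝ,
        -- continuous piecewise polynomials of degree `3k`
        (∀ i ∈ 𝒯.nodes k,
          ψ i ∈ LagrangeFE.lagrangeSpace Ω 𝒯.cells (3 * k) ∧ ContinuousOn (ψ i) (closure Ω)) ∧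
        -- product structure
        (∀ i ∈ 𝒯.nodes k,
          (∃ ζ ∈ LagrangeFE.lagrangeSpace (interior (𝒯.patch i)) (𝒯.cellsAt i) (2 * k),
            ∀ x, ψ i x = 𝒯.bernstein k i x * ζ x) ∧
          tsupport (ψ i) ⊆ tsupport (𝒯.bernstein k i)) ∧
        -- biorthogonality
        (∀ i ∈ 𝒯.nodes k, ∀ j ∈ 𝒯.nodes k,
          IntegrableOn (fun x => 𝒯.bernstein k i x * ψ j x) Ω ∧
          ∫ x in Ω, 𝒯.bernstein k i x * ψ j x = Set.indicator {i} 1 j) ∧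
        -- boundedness
        (∀ i ∈ 𝒯.nodes k,
          eLpNorm (ψ i) ∞ (volume.restrict (𝒯.patch i)) ≤
            ENNReal.ofReal (C₁ * (volume.real (𝒯.patch i))⁻¹)) ∧
        (∀ γ : ℝ, 𝒯.ShapeRegular γ → ∀ i ∈ 𝒯.nodes k,
          ∃ g : LagrangeFE.Eu d → LagrangeFE.Eu d,
            IntegrableOn g Ω ∧ LagrangeFE.HasWeakGradient Ω (ψ i) g ∧
            eLpNorm g ∞ (volume.restrict (𝒯.patch i)) ≤
              ENNReal.ofReal
                (C₂ γ * (Metric.diam (𝒯.patch i))⁻¹ * (volume.real (𝒯.patch i))⁻¹)) ∧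
        -- preservation of mass
        (∀ x ∈ closure Ω,
          ∑ i ∈ 𝒯.nodes k, (∫ y in Ω, 𝒯.bernstein k i y) * ψ i x = 1) := by
  obtain ⟨C₁, C₂, h⟩ := proposition2p7_general d k hd hk
  refine ⟨C₁, C₂, fun Ω hΩ 𝒯 => ?_⟩
  obtain ⟨ψ, hspace, hprod, hbi, hbdd, hgrad, hmass⟩ := h Ω hΩ.interior_closure 𝒯
  exact ⟨ψ, hspace, hprod, hbi, hbdd, hgrad hΩ.connected_at_boundary, hmass⟩
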